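/- Let $\Sigma$ be a finite alphabet and $\mathcal X$ a finite, linearly ordered set of variables; put $\Gamma_{\mathcal X}=\{\vdash_x,\dashv_x : x\in\mathcal X\}$. A span of a word (document) $D\in\Sigma^*$ is a pair $[i,j\rangle$ with $1\le i\le j\le |D|+1$; spans $[i,j\rangle,[i',j'\rangle$ are disjoint if $j\le i'$ or $j'\le i$. A multispan-tuple over $D$ and $\mathcal X$ maps every $x\in\mathcal X$ to a set of pairwise disjoint spans of $D$, and a multispanner $E$ maps every $D\in\Sigma^*$ to a set $E(D)$ of multispan-tuples over $D$ and $\mathcal X$. Multispanner-expressions are $R ::= \varepsilon \mid a\in\Sigma \mid (R\cdot R)\mid (R+R)\mid R^*\mid x\{R\}$, where $x\{R\}$ is allowed only if $x$ does not appear in $R$. The expression $R$ defines a language $L(R)\subseteq(\Sigma\cup\Gamma_{\mathcal X})^*$ in the usual way, with $L(x\{R\})=\{\vdash_x\}L(R)\{\dashv_x\}$. A word $w\in L(R)$ describes the document obtained by erasing all brackets, and the multispan-tuple that maps $x$ to the set of the spans enclosed by an occurrence of $\vdash_x$ and the next occurrence of $\dashv_x$. The multispanner $[\![R]\!]$ maps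 $D$ to the set of the tuples described by those $w\in L(R)$ whose document is $D$. A regex multispanner is one of the form $[\![R]\!]$. For a multispan-tuple $t$ over $D$ let $\langle t,D\rangle=t[1]D[1]t[2]D[2]\cdots D[|D|]\,t[|D|+1]$, where $t[i]$ is the concatenation, over $x\in\mathcal X$ in increasing order, of the words $(\dashv_x)^c(\vdash_x\dashv_x)^e(\vdash_x)^o$ with $c,e,o\in\{0,1\}$ and $c=1$ iff $[j,i\rangle\in t(x)$ for some $j\ne i$, $e=1$ iff $[i,i\rangle\in t(x)$, $o=1$ iff $[i,j\rangle\in t(x)$ for some $j\neq i$. An ET program with input alphabet $\Sigma$ and output alphabet $\Omega$ is a pair $(E,T)$ of a multispanner $E$ over $\Sigma$ and $\mathcal X$ (for some $\mathcal X$) and a partial function $T:(\Sigma\cup\Gamma_{\mathcal X})^*\rightharpoonup\Omega^*$. Its semantics maps $D\in\Sigma^*$ to the bag $[\![E\cdot T]\!](D)=\{\!\{T(\langle t,D\rangle) : t\in E(D),\ T(\langle t,D\rangle)\text{ defined}\}\!\}$. The program is linear if $E$ is a regex multispanner and $T$ is a linear polyregular (also called regular) string-to-string function, meaning that $T$ is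 defined by a deterministic streaming string transducer: a machine with finitely many states and registers, a partial deterministic transition function that attaches to each transition a copyless (partial) assignment of words over registers and output letters to the registers, all registers initially holding $\varepsilon$, and a partial final function that assigns to states output words over registers and output letters in which every register occurs at most once. **Theorem.** Let $\Sigma,\Omega,\Pi$ be finite alphabets, let $(E_1,T_1)$ be a linear ET program with input alphabet $\Sigma$ and output alphabet $\Omega$, and let $(E_2,T_2)$ be a linear ET program with input alphabet $\Omega$ and output alphabet $\Pi$. Then there is a linear ET program $(E,T)$ with input alphabet $\Sigma$ and output alphabet $\Pi$ such that for every $D\in\Sigma^*$ $$[\![E\cdot T]\!](D)=\bigcup_{D'\in[\![E_1\cdot T_1]\!](D)}[\![E_2\cdot T_2]\!](D')=[\![(E_1\cdot T_1)\circ(E_2\cdot T_2)]\!](D),$$ where $\bigcup$ is the additive union of bags, taken over all occurrences of $D'$ in the bag $[\![E_1\cdot T_1]\!](D)$. Moreover, $T$ can be chosen such that, for some constant $c$, $|T(w)|\le c\,|w|$ for all $w$ for which $T(w)$ is defined. -/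

import Mathlib

namespace ET

/-! ### Multispans and multispanners -/

/-- The alphabet `A ∪ Γ_X`: letters of `A` together with an opening and a closing bracket for
every variable of `X`. -/
inductive RefSym (A X : Type*) where
  | letter (a : A) : RefSym A X
  | opn (x : X) : RefSym A X
  | cls (x : X) : RefSym A X

/-- Spans of a document of length `n`: pairs `i ≤ j` of positions. Positions are counted from `0`,
so `(i, j)` stands for the factor made of the letters with (0-based) indices `i, …, j - 1`. -/
abbrev Span (n : ℕ) : Type := {p : Fin (n + 1) × Fin (n + 1) // p.1 ≤ p.2}

def Span.start {n : ℕ} (s : Span n) : Fin (n + 1) := s.1.1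

def Span.finish {n : ℕ} (s : Span n) : Fin (n + 1) := s.1.2

def Span.IsDisjoint {n : ℕ} (s s' : Span n) : Prop := s.finish ≤ s'.start ∨ s'.finish ≤ s.start

/-- A multispan is a set of pairwise disjoint spans. -/
def IsMultispan {n : ℕ} (S : Finset (Span n)) : Prop :=
  ∀ s ∈ S, ∀ s' ∈ S, s ≠ s' → s.IsDisjoint s'

/-- Multispan-tuples over a document of length `n` and the variables `X`. -/
abbrev MultispanTuple (n : ℕ) (X : Type*) : Type _ :=
  {t : X → Finset (Span n) // ∀ x, IsMultispan (t x)}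

/-- A multispanner maps every document to a set of multispan-tuples over this document. -/
abbrev Multispanner (A X : Type*) : Type _ :=
  (D : List A) → Set (MultispanTuple D.length X)

/-! ### Multiref-words -/

/-- The document described by a word over `A ∪ Γ_X`: erase all brackets. -/
def doc {A X : Type*} : List (RefSym A X) → List A
  | [] => []
  | .letter a :: w => a :: doc w
  | .opn _ :: w => doc w
  | .cls _ :: w => doc w

/-- A matching pair of brackets of `x` in `w` (an opening bracket and the next bracket of `x`, which
is a closing one) encloses the span from position `i` to position `j` of `doc w`. -/
def HasSpan {A X : Type*} (w : List (RefSym A X)) (x : X) (i j : ℕ) : Prop :=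
  ∃ u v z : List (RefSym A X),
    w = u ++ [RefSym.opn x] ++ v ++ [RefSym.cls x] ++ z ∧
    RefSym.opn x ∉ v ∧ RefSym.cls x ∉ v ∧
    i = (doc u).length ∧ j = (doc u).length + (doc v).length

/-- The multispanner described by a language `L` of multiref-words: it maps `D` to the set of the
multispan-tuples described by those `w ∈ L` with `doc w = D`. -/
def languageMultispanner {A X : Type*} (L : Language (RefSym A X)) : Multispanner A X :=
  fun D => {t | ∃ w ∈ L, doc w = D ∧ ∀ (x : X) (s : Span D.length),
    s ∈ t.1 x ↔ HasSpan w x s.start s.finish}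

/-! ### Regex multispanners -/

/-- Multispanner-expressions, before the side condition on variables is imposed. -/
inductive Expr (A X : Type*) where
  | eps : Expr A X
  | sym (a : A) : Expr A X
  | cat (R R' : Expr A X) : Expr A X
  | alt (R R' : Expr A X) : Expr A X
  | star (R : Expr A X) : Expr A X
  | bind (x : X) (R : Expr A X) : Expr A X

/-- The variable `x` appears in the expression. -/
def Expr.Mentions {A X : Type*} (x : X) : Expr A X → Prop
  | .eps => False
  | .sym _ => False
  | .cat R R' => R.Mentions x ∨ R'.Mentions x
  | .alt R R' => R.Mentions x ∨ R'.Mentions x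
  | .star R => R.Mentions x
  | .bind y R => x = y ∨ R.Mentions x

/-- The side condition of multispanner-expressions: `x{R}` is formed only if `x` does not appear
in `R`. -/
def Expr.WellFormed {A X : Type*} : Expr A X → Prop
  | .eps => True
  | .sym _ => True
  | .cat R R' => R.WellFormed ∧ R'.WellFormed
  | .alt R R' => R.WellFormed ∧ R'.WellFormed
  | .star R => R.WellFormed
  | .bind x R => ¬ R.Mentions x ∧ R.WellFormed

open scoped Computability in
/-- The language of multiref-words defined by an expression. -/
def Expr.lang {A X : Type*} : Expr A X → Language (RefSym A X)
  | .eps => 1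
  | .sym a => {[RefSym.letter a]}
  | .cat R R' => R.lang * R'.lang
  | .alt R R' => R.lang + R'.lang
  | .star R => R.lang∗
  | .bind x R => {[RefSym.opn x]} * R.lang * {[RefSym.cls x]}

def IsRegexMultispanner {A X : Type*} (E : Multispanner A X) : Prop :=
  ∃ R : Expr A X, R.WellFormed ∧ E = languageMultispanner R.lang

/-! ### The unique encoding of a multispan-tuple and a document as a multiref-word -/

/-- The word `t[i, x]`, of the form `(⊣x)^c (⊢x ⊣x)^e (⊢x)^o` with `c, e, o ∈ {0, 1}`. -/
def gapVar {A X : Type*} {n : ℕ} (t : MultispanTuple n X) (i : Fin (n + 1)) (x : X) :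
    List (RefSym A X) :=
  (if ∃ s ∈ t.1 x, s.finish = i ∧ s.start ≠ i then [RefSym.cls x] else []) ++
  (if ∃ s ∈ t.1 x, s.start = i ∧ s.finish = i then [RefSym.opn x, RefSym.cls x] else []) ++
  (if ∃ s ∈ t.1 x, s.start = i ∧ s.finish ≠ i then [RefSym.opn x] else [])

/-- The word `t[i]`: the concatenation of the words `t[i, x]`, with `x` ranging over the variables
in increasing order. -/
def gap {A X : Type*} [Fintype X] [LinearOrder X] {n : ℕ} (t : MultispanTuple n X)
    (i : Fin (n + 1)) : List (RefSym A X) :=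
  (Finset.univ.sort (fun x y : X => x ≤ y)).flatMap (fun x => gapVar t i x)

/-- The encoding `t[0] D[0] t[1] D[1] ⋯ D[n - 1] t[n]` of a document `D` of length `n` and a
multispan-tuple `t` over `D`. -/
def encode {A X : Type*} [Fintype X] [LinearOrder X] (D : List A)
    (t : MultispanTuple D.length X) : List (RefSym A X) :=
  (List.finRange D.length).flatMap (fun i => gap t i.castSucc ++ [RefSym.letter (D.get i)]) ++
    gap t (Fin.last D.length)

/-! ### Extract-transform programs -/

/-- A string-to-string function is a partial function on words; `none` means undefined. -/
abbrev StringFun (A B : Type*) : Type _ := List A → Option (List B)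

/-- An extract-transform program with input alphabet `A`, variables `X` and output alphabet `B`. -/
structure Program (A X B : Type*) where
  E : Multispanner A X
  T : StringFun (RefSym A X) B

/-- The bag of the words `T(⟨t, D⟩)` with `t ∈ E(D)`, each such `t` with `T(⟨t, D⟩)` defined
contributing one occurrence. -/
noncomputable def Program.eval {A X B : Type*} [Fintype X] [LinearOrder X]
    (P : Program A X B) (D : List A) : Multiset (List B) :=
  (Set.toFinite (P.E D)).toFinset.val.filterMap (fun t => P.T (encode D t))

/-- The semantics of the composition of two programs: the bag union of the bags `⟦P₂⟧(D')`, where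
every occurrence of a document `D'` in the bag `⟦P₁⟧(D)` contributes to the union. -/
noncomputable def compEval {A X₁ B X₂ C : Type*} [Fintype X₁] [LinearOrder X₁]
    [Fintype X₂] [LinearOrder X₂] (P₁ : Program A X₁ B) (P₂ : Program B X₂ C)
    (D : List A) : Multiset (List C) :=
  (P₁.eval D).bind (fun D' => P₂.eval D')

/-! ### Deterministic streaming string transducers -/

/-- Assignments: partial functions from registers to words over registers and output letters. -/
abbrev Assignment (R B : Type*) : Type _ := R → Option (List (R ⊕ B))

/-- Valuations: assignments without registers on the right-hand side. -/
abbrev Valuation (R B : Type*) : Type _ := R → Option (List B)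

/-- An assignment is copyless if every register occurs at most once in all its right-hand sides
together. -/
def Assignment.Copyless {R B : Type*} [Fintype R] [DecidableEq R] (σ : Assignment R B) : Prop :=
  ∀ X : R, ∑ Y : R, ((σ Y).getD []).countP (fun c => c.getLeft? = some X) ≤ 1

/-- The extension of a valuation to words over registers and letters; it is undefined as soon as
some register of the word has no value. -/
def Valuation.extend {R B : Type*} (ν : Valuation R B) : List (R ⊕ B) → Option (List B)
  | [] => some []
  | .inl X :: w => (ν X).bind fun u => (Valuation.extend ν w).map fun v => u ++ v
  | .inr b :: w => (Valuation.extend ν w).map fun v => b :: v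

/-- The valuation `ν ∘ σ`. -/
def Valuation.comp {R B : Type*} (ν : Valuation R B) (σ : Assignment R B) : Valuation R B :=
  fun X => (σ X).bind fun w => ν.extend w

/-- Deterministic streaming string transducers with input alphabet `A` and output alphabet `B`. -/
structure DSST (A B : Type*) where
  /-- states -/
  Q : Type
  /-- registers -/
  R : Type
  [finQ : Fintype Q]
  [finR : Fintype R]
  [decR : DecidableEq R]
  /-- partial transition function -/
  Δ : Q → A → Option (Assignment R B × Q)
  copyless : ∀ q a σ q', Δ q a = some (σ, q') → σ.Copyless
  /-- initial state -/
  q₀ : Q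
  /-- partial final function -/
  F : Q → Option (List (R ⊕ B))
  final_once : ∀ q w, F q = some w → ∀ X : R, w.countP (fun c => c.getLeft? = some X) ≤ 1

/-- The output of the run on the given word that starts in the configuration `(q, ν)`, if there is
such a run and it is accepting. -/
def DSST.evalFrom {A B : Type*} (𝒯 : DSST A B) :
    List A → 𝒯.Q → Valuation 𝒯.R B → Option (List B)
  | [], q, ν => (𝒯.F q).bind fun w => ν.extend w
  | a :: w, q, ν => (𝒯.Δ q a).bind fun p => DSST.evalFrom 𝒯 w p.2 (ν.comp p.1)

/-- The string-to-string function defined by a DSST; initially all registers hold the empty word. -/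
def DSST.eval {A B : Type*} (𝒯 : DSST A B) : StringFun A B :=
  fun w => 𝒯.evalFrom w 𝒯.q₀ (fun _ => some [])

/-! ### Linear programs -/

/-- The length of the output is bounded by a constant multiple of the length of the input. -/
def HasLinearGrowth {A B : Type*} (T : StringFun A B) : Prop :=
  ∃ c : ℕ, ∀ w v, T w = some v → v.length ≤ c * w.length

/-- A linear ET program consists of a regex multispanner and a string-to-string function defined by
a deterministic streaming string transducer. -/
def Program.IsLinear {A X B : Type*} (P : Program A X B) : Prop :=
  IsRegexMultispanner P.E ∧ ∃ 𝒯 : DSST (RefSym A X) B, P.T = 𝒯.eval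

end ET

/-! Linear programs are matched with nondeterministic streaming string transducers (`NSST`) whose
transitions and final words form bags, so that every accepting run contributes one output. The
theorem then rests on three facts.

From programs to transducers (`Program.IsLinear.exists_nsst`). A tuple over D is determined by a
list of |D| + 1 labels from a finite set (`tupleLabels_injective`). The transducer guesses the
labels, runs the DSST on the resulting encoding, and checks by a subset construction that some word
of the regular language `R.lang` has these labels. Subsets are essential for multiplicities: several
words may describe one tuple, which counts once.

Composition (`NSST.exists_comp`). The second transducer N₂ reads a word that N₁ assembles from
registers, not from left to right. On the remaining input, a run of N₁ outputs a word f over its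
present registers, each occurring at most once. The composite guesses the list `regs f` and, for
every register in it, the states of N₂ before and after the content and the assignment N₂ computes
on it. These claims form a queue that a run of N₂ on f uses up in order. The assignments are
unbounded, but a copyless assignment is a finite shape together with boundedly many words between
its registers: shapes go into the state, words into registers. The bags agree because runs on σ(f)
correspond to claims for f followed by runs on f (`NSST.fullRuns_subst`), and because a queue for
another list of registers yields nothing (`NSST.outputsOn_eq_zero`). The composite is copyless
because N₂ moves the words in the queue and never duplicates them (`NSST.runs_spec`).

From transducers to programs (`NSST.exists_program`). A regex multispanner marks every gap by an
empty span of exactly one of m variables, which serves as the index of the transition or final word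
to use. A transducer that reads the indices is deterministic. Its output has length at most K(|w| +
1) by copylessness, and it rejects the empty word, so the growth is linear. -/

set_option linter.unusedSectionVars false

namespace ET

/-! ### Partial substitutions and weights -/

/-- The extension of a partial map from letters to words to a partial map on words. -/
def subst {L M : Type*} (k : L → Option (List M)) : List L → Option (List M)
  | [] => some []
  | x :: w => (k x).bind fun u => (subst k w).map fun v => u ++ v

section Subst

variable {L M N R S B G G' : Type*}

theorem subst_append (k : L → Option (List M)) (u v : List L) :
    subst k (u ++ v) = (subst k u).bind fun u' => (subst k v).map fun v' => u' ++ v' := by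
  induction u with
  | nil => cases h : subst k v <;> simp [subst, h]
  | cons x u ih =>
    simp only [List.cons_append, subst, ih]
    cases k x <;> cases subst k u <;> cases subst k v <;> simp

theorem subst_subst (k : L → Option (List M)) (k' : M → Option (List N)) (w : List L) :
    (subst k w).bind (subst k') = subst (fun x => (k x).bind (subst k')) w := by
  induction w with
  | nil => rfl
  | cons x w ih =>
    simp only [subst, ← ih]
    cases k x with
    | none => rfl
    | some u =>
      cases subst k w with
      | none => simp
      | some v => simp [subst_append, Option.map]

theorem subst_pure (w : List L) : subst (fun x => some [x]) w = some w := by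
  induction w with
  | nil => rfl
  | cons x w ih => simp [subst, ih]

theorem subst_map (f : L → M) (k : M → Option (List N)) (w : List L) :
    subst k (w.map f) = subst (fun x => k (f x)) w := by
  induction w with
  | nil => rfl
  | cons x w ih => simp [subst, ih]

theorem subst_some_map (f : L → M) (w : List L) :
    subst (fun x => some [f x]) w = some (w.map f) := by
  rw [← subst_map f (fun y => some [y]), subst_pure]

/-- The total weight of the letters of a word. -/
def wt (ω : L → ℕ) (w : List L) : ℕ := (w.map ω).sum

@[simp] theorem wt_nil (ω : L → ℕ) : wt ω [] = 0 := rfl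

@[simp] theorem wt_cons (ω : L → ℕ) (x : L) (w : List L) : wt ω (x :: w) = ω x + wt ω w := by
  simp [wt]

@[simp] theorem wt_append (ω : L → ℕ) (u v : List L) : wt ω (u ++ v) = wt ω u + wt ω v := by
  simp [wt]

theorem wt_map (f : L → M) (ω : M → ℕ) (w : List L) : wt ω (w.map f) = wt (fun x => ω (f x)) w := by
  simp [wt, Function.comp_def]

/-- Weights are additive, so a substitution merely changes the weight of each letter. Indicator
weights turn this into a statement on copylessness, the constant weight 1 into one on lengths. -/
theorem wt_subst {k : L → Option (List M)} {w : List L} {v : List M} (ω : M → ℕ)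
    (h : subst k w = some v) : wt ω v = wt (fun x => wt ω ((k x).getD [])) w := by
  induction w generalizing v with
  | nil => simp_all [subst]
  | cons x w ih =>
    simp only [subst, Option.bind_eq_some_iff, Option.map_eq_some_iff] at h
    obtain ⟨u, hu, v', hv', rfl⟩ := h
    simp [ih hv', hu]

theorem wt_getD_subst_le (k : L → Option (List M)) (w : List L) (ω : M → ℕ) :
    wt ω ((subst k w).getD []) ≤ wt (fun x => wt ω ((k x).getD [])) w := by
  cases h : subst k w with
  | none => simp
  | some v => simp [wt_subst ω h]

theorem wt_mono {ω ω' : L → ℕ} (h : ∀ x, ω x ≤ ω' x) (w : List L) : wt ω w ≤ wt ω' w := by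
  induction w with
  | nil => simp
  | cons x w ih => simpa using add_le_add (h x) ih

theorem wt_one_eq_length (w : List L) : wt (fun _ => 1) w = w.length := by
  simp [wt]

theorem wt_eq_countP (p : L → Bool) (w : List L) : wt (fun x => if p x then 1 else 0) w = w.countP p := by
  induction w with
  | nil => rfl
  | cons x w ih => simp [List.countP_cons, ih, add_comm]

end Subst

/-! ### Composition of assignments -/

section Assignments

variable {R S B G G' : Type*}

/-- The substitution defined by an assignment, letters being kept. -/
def lift (α : Assignment R G) : R ⊕ G → Option (List (R ⊕ G)) :=
  Sum.elim α fun g => some [.inr g]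

/-- The substitution defined by a valuation, letters being kept. -/
def value (ν : Valuation R G) : R ⊕ G → Option (List G) :=
  Sum.elim ν fun g => some [g]

/-- The assignment that leaves all registers unchanged. -/
def idAssignment : Assignment R G := fun X => some [.inl X]

/-- The assignment with the same effect as `α` followed by `β`. -/
def comp (α β : Assignment R G) : Assignment R G := fun X => (β X).bind (subst (lift α))

/-- The valuation in which all registers hold the empty word. -/
def emptyValuation : Valuation R G := fun _ => some []

theorem extend_eq_subst (ν : Valuation R G) (w : List (R ⊕ G)) :
    Valuation.extend ν w = subst (value ν) w := by
  induction w with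
  | nil => rfl
  | cons x w ih =>
    cases x with
    | inl X => simp [Valuation.extend, subst, value, ih]
    | inr b => simp [Valuation.extend, subst, value, ih]

theorem lift_idAssignment : lift (idAssignment : Assignment R G) = fun x => some [x] := by
  funext x; cases x <;> rfl

@[simp] theorem comp_id (α : Assignment R G) : comp α idAssignment = α := by
  funext X
  simp [comp, idAssignment, subst, lift]

@[simp] theorem id_comp (α : Assignment R G) : comp idAssignment α = α := by
  funext X
  simp only [comp, lift_idAssignment]
  cases α X <;> simp [subst_pure]

theorem bind_subst_lift (α β : Assignment R G) (w : List (R ⊕ G)) :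
    (subst (lift β) w).bind (subst (lift α)) = subst (lift (comp α β)) w := by
  rw [subst_subst]
  congr 1
  funext x
  cases x <;> simp [lift, comp, subst]

theorem comp_assoc (α β γ : Assignment R G) : comp (comp α β) γ = comp α (comp β γ) := by
  funext X
  simp only [comp, Option.bind_assoc]
  congr 1
  funext w
  exact (bind_subst_lift α β w).symm

theorem bind_subst_value (ν : Valuation R G) (α : Assignment R G) (w : List (R ⊕ G)) :
    (subst (lift α) w).bind (subst (value ν)) = subst (value (ν.comp α)) w := by
  rw [subst_subst]
  congr 1
  funext x
  cases x with
  | inl X =>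
    simp only [lift, value, Sum.elim_inl, Valuation.comp]
    congr 1
    funext w
    exact (extend_eq_subst ν w).symm
  | inr b => simp [lift, value, subst]

theorem valuation_comp_comp (ν : Valuation R G) (α β : Assignment R G) :
    ν.comp (comp α β) = (ν.comp α).comp β := by
  funext X
  simp only [comp, Valuation.comp, Option.bind_assoc]
  congr 1
  funext w
  simp only [extend_eq_subst]
  rw [← bind_subst_value]

theorem valuation_comp_id (ν : Valuation R G) : ν.comp idAssignment = ν := by
  funext X
  simp [Valuation.comp, idAssignment, Valuation.extend]

variable [Fintype R] [DecidableEq R]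

/-- The total weight of the right-hand sides of an assignment, registers being weighted by `W` and
letters by `V`. -/
def totalWt (W : R → ℕ) (V : G → ℕ) (α : Assignment R G) : ℕ :=
  ∑ X, wt (Sum.elim W V) ((α X).getD [])

/-- Separates the registers, which enter through their multiplicities, from the letters;
copylessness bounds the multiplicities by 1. -/
theorem wt_sum_elim (W : R → ℕ) (V : G → ℕ) (w : List (R ⊕ G)) :
    wt (Sum.elim W V) w =
      ∑ Z, w.countP (fun c => c.getLeft? = some Z) * W Z + wt (Sum.elim 0 V) w := by
  induction w with
  | nil => simp
  | cons x w ih =>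
    cases x with
    | inl Y =>
      simp only [wt_cons, ih, Sum.elim_inl, List.countP_cons, Sum.getLeft?_inl, add_mul,
        Finset.sum_add_distrib, Pi.zero_apply]
      simp
      ring
    | inr g =>
      simp [wt_cons, ih]
      ring

theorem Assignment.Copyless.totalWt_le {β : Assignment R G} (h : β.Copyless) (W : R → ℕ)
    (V : G → ℕ) : totalWt W V β ≤ ∑ Z, W Z + totalWt 0 V β := by
  unfold totalWt
  rw [Finset.sum_congr rfl fun X _ => wt_sum_elim W V _, Finset.sum_add_distrib, Finset.sum_comm]
  refine Nat.add_le_add_right (Finset.sum_le_sum fun Z _ => ?_) _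
  rw [← Finset.sum_mul]
  exact (Nat.mul_le_mul_right _ (h Z)).trans (one_mul _).le

/-- Composition inserts the right-hand sides of α for the registers in β, each at most once. Hence
this is `Assignment.Copyless.totalWt_le` with every register weighted by its right-hand side in α.
-/
theorem totalWt_comp_le (α : Assignment R G) {β : Assignment R G} (h : β.Copyless) (W : R → ℕ)
    (V : G → ℕ) : totalWt W V (comp α β) ≤ totalWt W V α + totalWt 0 V β := by
  refine le_trans ?_ (h.totalWt_le (fun Z => wt (Sum.elim W V) ((α Z).getD [])) V)
  refine Finset.sum_le_sum fun X _ => ?_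
  simp only [comp]
  cases hX : β X with
  | none => simp
  | some w =>
    refine (wt_getD_subst_le _ _ _).trans (wt_mono (fun x => ?_) _)
    cases x <;> simp [lift]

theorem wt_indicator_eq_countP (Z : R) (w : List (R ⊕ G)) :
    wt (Sum.elim (fun Y => if Y = Z then 1 else 0) 0) w =
      w.countP (fun c => c.getLeft? = some Z) := by
  rw [← wt_eq_countP]
  congr 1
  funext x
  cases x <;> simp

theorem copyless_iff_totalWt (α : Assignment R G) :
    α.Copyless ↔ ∀ Z, totalWt (fun Y => if Y = Z then 1 else 0) 0 α ≤ 1 := by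
  simp only [Assignment.Copyless, totalWt, wt_indicator_eq_countP]

theorem totalWt_zero_zero (α : Assignment R G) : totalWt 0 0 α = 0 := by
  simp only [totalWt]
  refine Finset.sum_eq_zero fun X _ => ?_
  have : (Sum.elim 0 0 : R ⊕ G → ℕ) = fun _ => 0 := by funext x; cases x <;> rfl
  simp [wt, this]

theorem Assignment.Copyless.comp {α β : Assignment R G} (hα : α.Copyless) (hβ : β.Copyless) :
    (comp α β).Copyless := by
  rw [copyless_iff_totalWt] at hα ⊢
  intro Z
  refine (totalWt_comp_le α hβ _ _).trans ?_
  rw [totalWt_zero_zero]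
  exact hα Z

theorem totalWt_id (W : R → ℕ) (V : G → ℕ) :
    totalWt W V (idAssignment : Assignment R G) = ∑ Z, W Z := by
  simp [totalWt, idAssignment]

theorem copyless_id : (idAssignment : Assignment R G).Copyless := by
  rw [copyless_iff_totalWt]
  intro Z
  simp [totalWt_id]

end Assignments

/-! ### Nondeterministic streaming string transducers -/

/-- Streaming string transducers with a bag of transitions for every state and letter, and a bag of
final words for every state. -/
structure NSST (A B : Type*) where
  /-- states -/
  Q : Type
  /-- registers -/
  R : Type
  [finQ : Finite Q]
  [finR : Fintype R]
  [decR : DecidableEq R]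
  /-- transitions -/
  δ : Q → A → Multiset (Assignment R B × Q)
  copyless : ∀ q a, ∀ p ∈ δ q a, p.1.Copyless
  /-- initial state -/
  q₀ : Q
  /-- final words -/
  F : Q → Multiset (List (R ⊕ B))
  final_once : ∀ q, ∀ w ∈ F q, ∀ X : R, w.countP (fun c => c.getLeft? = some X) ≤ 1

namespace NSST

attribute [instance] NSST.finQ NSST.finR NSST.decR

variable {A B : Type*}

/-- The bag of the words over registers and letters that the runs from `q` on a word output, as
functions of the initial contents of the registers. -/
def sym (N : NSST A B) : List A → N.Q → Multiset (List (N.R ⊕ B))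
  | [], q => N.F q
  | a :: w, q => (N.δ q a).bind fun p => (sym N w p.2).filterMap (subst (lift p.1))

/-- The bag of the outputs of all runs. -/
def eval (N : NSST A B) (w : List A) : Multiset (List B) :=
  (N.sym w N.q₀).filterMap (subst (value emptyValuation))

theorem countP_subst_lift_le {R B : Type*} [Fintype R] [DecidableEq R] {σ : Assignment R B}
    (hσ : σ.Copyless) {w v : List (R ⊕ B)}
    (hw : ∀ X : R, w.countP (fun c => c.getLeft? = some X) ≤ 1)
    (h : subst (lift σ) w = some v) (X : R) : v.countP (fun c => c.getLeft? = some X) ≤ 1 := by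
  rw [copyless_iff_totalWt] at hσ
  rw [← wt_indicator_eq_countP, wt_subst _ h]
  refine le_trans ?_ (hσ X)
  set W : R → ℕ := fun Z => wt (Sum.elim (fun Y => if Y = X then 1 else 0) 0) ((σ Z).getD [])
  have : (fun x => wt (Sum.elim (fun Y => if Y = X then 1 else 0) 0) ((lift σ x).getD [])) =
      Sum.elim W (0 : B → ℕ) := by
    funext x; cases x <;> simp [lift, W]
  rw [this, wt_sum_elim]
  have h0 : (Sum.elim 0 0 : R ⊕ B → ℕ) = fun _ => 0 := by funext x; cases x <;> rfl
  simp only [h0, wt, List.map_const', List.sum_replicate, smul_zero, add_zero]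
  exact Finset.sum_le_sum fun Z _ => (Nat.mul_le_mul_right _ (hw Z)).trans (one_mul _).le

/-- Makes `regs v` duplicate-free, so that the composition has only finitely many lists of registers
to guess from. -/
theorem countP_le_one_of_mem_sym (N : NSST A B) (w : List A) (q : N.Q) :
    ∀ v ∈ N.sym w q, ∀ X : N.R, v.countP (fun c => c.getLeft? = some X) ≤ 1 := by
  induction w generalizing q with
  | nil => exact N.final_once q
  | cons a w ih =>
    intro v hv
    simp only [sym, Multiset.mem_bind, Multiset.mem_filterMap] at hv
    obtain ⟨p, hp, u, hu, huv⟩ := hv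
    exact countP_subst_lift_le (N.copyless q a p hp) (ih p.2 u hu) huv

end NSST

/-! ### Bags -/

section Bags

variable {α β γ : Type*}

/-- The elements of a finite type, as a bag. -/
noncomputable def univBag (α : Type*) [Finite α] : Multiset α :=
  (@Finset.univ α (Fintype.ofFinite α)).val

theorem mem_univBag [Finite α] (a : α) : a ∈ univBag α :=
  @Finset.mem_univ α (Fintype.ofFinite α) a

theorem nodup_univBag (α : Type*) [Finite α] : (univBag α).Nodup :=
  (@Finset.univ α (Fintype.ofFinite α)).nodup

/-- Removes a guess from an identity of bags: if all values but one lead to nothing, the right one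
is counted exactly once. -/
theorem bind_eq_of_nodup {s : Multiset α} (hs : s.Nodup) {a : α} (ha : a ∈ s) {f : α → Multiset β}
    (h : ∀ b ∈ s, b ≠ a → f b = 0) : s.bind f = f a := by
  obtain ⟨t, rfl⟩ := Multiset.exists_cons_of_mem ha
  rw [Multiset.cons_bind, Multiset.bind_congr (g := fun _ => 0), Multiset.bind_zero, add_zero]
  intro b hb
  refine h b (Multiset.mem_cons_of_mem hb) fun hba => ?_
  exact (Multiset.nodup_cons.1 hs).1 (hba ▸ hb)

end Bags

/-! ### Runs of a transducer on words over registers and letters -/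

section Substitutions

variable {R B G G' : Type*}

/-- Rename the letters of an assignment. -/
def mapLetters (ι : G → G') (σ : Assignment R G) : Assignment R G' :=
  fun X => (σ X).map (List.map (Sum.map id ι))

/-- A substitution of letters, registers being kept. -/
def keep (θ : G → Option (List G')) : R ⊕ G → Option (List (R ⊕ G')) :=
  Sum.elim (fun X => some [.inl X]) fun g => (θ g).map (List.map .inr)

/-- Substitute the letters of an assignment. -/
def substLetters (θ : G → Option (List G')) (α : Assignment R G) : Assignment R G' :=
  fun X => (α X).bind (subst (keep θ))

theorem substLetters_id (θ : G → Option (List G')) :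
    substLetters θ (idAssignment : Assignment R G) = idAssignment := by
  funext X
  simp [substLetters, idAssignment, subst, keep]

theorem subst_lift_map_inr (α : Assignment R G) (w : List G) :
    subst (lift α) (w.map .inr) = some (w.map .inr) := by
  rw [subst_map]
  exact subst_some_map _ w

/-- The words substituted for letters contain no registers, so the assignment α does not act on them
and the two substitutions commute. -/
theorem substLetters_comp (θ : G → Option (List G')) (α β : Assignment R G) :
    substLetters θ (comp α β) = comp (substLetters θ α) (substLetters θ β) := by
  funext X
  simp only [substLetters, comp, Option.bind_assoc]
  congr 1
  funext w
  rw [subst_subst, subst_subst]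
  congr 1
  funext x
  cases x with
  | inl Z => simp [lift, keep, subst, substLetters]
  | inr g =>
    cases h : θ g with
    | none => simp [lift, keep, subst, h]
    | some u =>
      have := subst_lift_map_inr (substLetters θ α) u
      simp_all [lift, keep, subst]

theorem subst_keep_map {H : Type*} {θ : G → Option (List G')} {ι : H → G} {ι' : H → G'}
    (hθ : ∀ c, θ (ι c) = some [ι' c]) (w : List (R ⊕ H)) :
    subst (keep θ) (w.map (Sum.map id ι)) = some (w.map (Sum.map id ι')) := by
  rw [subst_map, ← subst_some_map]
  congr 1
  funext x
  cases x <;> simp [keep, hθ]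

theorem substLetters_mapLetters {H : Type*} {θ : G → Option (List G')} {ι : H → G} {ι' : H → G'}
    (hθ : ∀ c, θ (ι c) = some [ι' c]) (σ : Assignment R H) :
    substLetters θ (mapLetters ι σ) = mapLetters ι' σ := by
  funext X
  simp only [substLetters, mapLetters]
  cases σ X <;> simp [subst_keep_map hθ]

/-- The registers of a word, from left to right. -/
def regs (w : List (R ⊕ G)) : List R := w.filterMap Sum.getLeft?

@[simp] theorem regs_nil : regs ([] : List (R ⊕ G)) = [] := rfl

@[simp] theorem regs_inl (X : R) (w : List (R ⊕ G)) : regs (.inl X :: w) = X :: regs w := rfl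

@[simp] theorem regs_inr (g : G) (w : List (R ⊕ G)) : regs (.inr g :: w) = regs w := rfl

theorem count_regs [DecidableEq R] (X : R) (w : List (R ⊕ G)) :
    (regs w).count X = w.countP (fun c => c.getLeft? = some X) := by
  induction w with
  | nil => rfl
  | cons x w ih =>
    cases x with
    | inl Y => simp [List.count_cons, List.countP_cons, ih]
    | inr g => simp [ih]

end Substitutions

namespace NSST

variable {B C : Type*} (N : NSST B C) {R G G' : Type*}

/-- A claim about the content of a register: the register, the states before and after a run on
its content, and the assignment that this run computes. -/
abbrev Entry (R G : Type*) : Type _ := R × N.Q × N.Q × Assignment N.R G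

open Classical in
/-- One step of a run on a word over registers and letters. A register has to be the one in the
first entry of the queue. -/
noncomputable def step (ι : C → G) :
    R ⊕ B → N.Q × List (N.Entry R G) → Multiset (Assignment N.R G × N.Q × List (N.Entry R G))
  | .inr b, s => (N.δ s.1 b).map fun r => (mapLetters ι r.1, r.2, s.2)
  | .inl _, (_, []) => 0
  | .inl Y, (p, e :: E) => if e.1 = Y ∧ e.2.1 = p then {(e.2.2.2, e.2.2.1, E)} else 0

/-- Runs on a word over registers and letters. -/
noncomputable def runs (ι : C → G) : List (R ⊕ B) → N.Q × List (N.Entry R G) →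
    Multiset (Assignment N.R G × N.Q × List (N.Entry R G))
  | [], s => {(idAssignment, s)}
  | x :: w, s => (N.step ι x s).bind fun r => (runs ι w r.2).map fun r' => (comp r.1 r'.1, r'.2)

theorem runs_append (ι : C → G) (u v : List (R ⊕ B)) (s : N.Q × List (N.Entry R G)) :
    N.runs ι (u ++ v) s =
      (N.runs ι u s).bind fun r => (N.runs ι v r.2).map fun r' => (comp r.1 r'.1, r'.2) := by
  induction u generalizing s with
  | nil => simp [runs]
  | cons x u ih =>
    simp only [List.cons_append, runs, ih, Multiset.bind_assoc, Multiset.map_bind,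
      Multiset.bind_map, Multiset.map_map, Function.comp_def, comp_assoc]

/-- The result of a run that has used up the queue. -/
def finished : Assignment N.R G × N.Q × List (N.Entry R G) → Option (Assignment N.R G × N.Q)
  | (α, p, []) => some (α, p)
  | (_, _, _ :: _) => none

/-- Runs that use up the queue. -/
noncomputable def fullRuns (ι : C → G) (w : List (R ⊕ B)) (s : N.Q × List (N.Entry R G)) :
    Multiset (Assignment N.R G × N.Q) :=
  (N.runs ι w s).filterMap N.finished

theorem finished_comp (α : Assignment N.R G) (r : Assignment N.R G × N.Q × List (N.Entry R G)) :
    N.finished (comp α r.1, r.2) = (N.finished r).map fun r' => (comp α r'.1, r'.2) := by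
  obtain ⟨β, p, _ | _⟩ := r <;> rfl

theorem fullRuns_append (ι : C → G) (u v : List (R ⊕ B)) (s : N.Q × List (N.Entry R G)) :
    N.fullRuns ι (u ++ v) s =
      (N.runs ι u s).bind fun r => (N.fullRuns ι v r.2).map fun r' => (comp r.1 r'.1, r'.2) := by
  simp only [fullRuns, runs_append, Multiset.filterMap_bind, Multiset.filterMap_map, Multiset.map_filterMap]
  refine Multiset.bind_congr fun r _ => ?_
  congr 1
  funext r'
  exact N.finished_comp _ _

theorem fullRuns_cons (ι : C → G) (x : R ⊕ B) (w : List (R ⊕ B)) (s : N.Q × List (N.Entry R G)) :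
    N.fullRuns ι (x :: w) s =
      (N.step ι x s).bind fun r => (N.fullRuns ι w r.2).map fun r' => (comp r.1 r'.1, r'.2) := by
  have := N.fullRuns_append ι [x] w s
  simpa [runs, Multiset.bind_map, Multiset.bind_assoc] using this

theorem fullRuns_nil (ι : C → G) (p : N.Q) (E : List (N.Entry R G)) :
    N.fullRuns ι [] (p, E) = if E = [] then {(idAssignment, p)} else 0 := by
  cases E <;> rfl

/-- The queues of entries for the given registers after the assignment `σ`, where the queue
of entries for the registers before the assignment is used up. -/
noncomputable def choices (ι : C → G) (σ : Assignment R B) :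
    List R → List (N.Entry R G) → Multiset (List (N.Entry R G))
  | [], [] => {[]}
  | [], _ :: _ => 0
  | Y :: ys, E => (univBag N.Q).bind fun p =>
      ((σ Y).elim 0 fun w => N.runs ι w (p, E)).bind fun r =>
        (choices ι σ ys r.2.2).map fun E' => (Y, p, r.2.1, r.1) :: E'

/-- A run on σ(f) splits uniquely at the borders of the blocks σ(Y). The part on a block, together
with the entries it consumes, becomes the entry of Y that a run on f then takes from the new queue.
-/
theorem fullRuns_subst (ι : C → G) (σ : Assignment R B) (f : List (R ⊕ B)) (p : N.Q)
    (E : List (N.Entry R G)) :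
    ((subst (lift σ) f).elim 0 fun w => N.fullRuns ι w (p, E)) =
      (N.choices ι σ (regs f) E).bind fun E' => N.fullRuns ι f (p, E') := by
  induction f generalizing p E with
  | nil => cases E <;> simp [subst, choices, fullRuns_nil]
  | cons x f ih =>
    cases x with
    | inr b =>
      have h : ((subst (lift σ) (.inr b :: f)).elim 0 fun w => N.fullRuns ι w (p, E)) =
          (N.δ p b).bind fun r =>
            ((subst (lift σ) f).elim 0 fun w => N.fullRuns ι w (r.2, E)).map fun r' =>
              (comp (mapLetters ι r.1) r'.1, r'.2) := by
        cases h : subst (lift σ) f with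
        | none => simp [subst, h]
        | some w =>
          have : subst (lift σ) (.inr b :: f) = some (.inr b :: w) := by
            rw [subst, h]; rfl
          simp [this, fullRuns_cons, step, Multiset.bind_map]
      simp only [h, ih, regs_inr, fullRuns_cons, step, Multiset.map_bind, Multiset.bind_map]
      -- The entries are chosen independently of the transition on `b`, so the two choices commute.
      exact Multiset.bind_bind _ _
    | inl Y =>
      have h : ((subst (lift σ) (.inl Y :: f)).elim 0 fun w => N.fullRuns ι w (p, E)) =
          ((σ Y).elim 0 fun w => N.runs ι w (p, E)).bind fun r =>
            ((subst (lift σ) f).elim 0 fun w => N.fullRuns ι w r.2).map fun r' =>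
              (comp r.1 r'.1, r'.2) := by
        cases h : subst (lift σ) f with
        | none => cases h' : σ Y <;> simp [subst, h]
        | some w =>
          cases h' : σ Y with
          | none => simp [subst, lift, h']
          | some u =>
            have : subst (lift σ) (.inl Y :: f) = some (u ++ w) := by
              rw [subst, h]; simp [lift, h']
            simp [this, fullRuns_append]
      rw [h]
      simp only [regs_inl, choices, Multiset.bind_assoc, Multiset.bind_map]
      -- The guessed start state of the block adds no multiplicity: `step` rejects every entry whose
      -- start state is not the current state `p`.
      rw [bind_eq_of_nodup (nodup_univBag _) (mem_univBag p)]
      · refine Multiset.bind_congr fun r _ => ?_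
        obtain ⟨α, p', E'⟩ := r
        simp only [ih, fullRuns_cons, step, Multiset.map_bind]
        simp
      · intro p' _ hp'
        simp [fullRuns_cons, step, hp']

/-- The outputs after a run. -/
noncomputable def outputs (ι : C → G) (r : Assignment N.R G × N.Q) : Multiset (List G) :=
  (N.F r.2).filterMap fun f =>
    subst (value (emptyValuation.comp r.1)) (f.map (Sum.map id ι))

/-- The outputs of all complete runs on a word over registers and letters. -/
noncomputable def outputsOn (ι : C → G) (E : List (N.Entry R G)) (w : List (R ⊕ B)) :
    Multiset (List G) :=
  (N.fullRuns ι w (N.q₀, E)).bind (N.outputs ι)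

/-- Substitute the letters of all assignments in a queue. -/
def substQueue (θ : G → Option (List G')) (E : List (N.Entry R G)) : List (N.Entry R G') :=
  E.map fun e => (e.1, e.2.1, e.2.2.1, substLetters θ e.2.2.2)

/-! ### Naturality of runs in the letters of the queue -/

section Naturality

variable {θ : G → Option (List G')} {ι : C → G} {ι' : C → G'} (hθ : ∀ c, θ (ι c) = some [ι' c])
include hθ

theorem step_substQueue (x : R ⊕ B) (p : N.Q) (E : List (N.Entry R G)) :
    N.step ι' x (p, N.substQueue θ E) =
      (N.step ι x (p, E)).map fun r => (substLetters θ r.1, r.2.1, N.substQueue θ r.2.2) := by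
  cases x with
  | inr b => simp [step, Multiset.map_map, substLetters_mapLetters hθ]
  | inl Y =>
    cases E with
    | nil => rfl
    | cons e E =>
      by_cases h : e.1 = Y ∧ e.2.1 = p <;> simp [step, substQueue, h]

/-- Runs copy the assignments of the queue without inspecting them, so letters may be substituted
before or after the run. The hypothesis on θ says that it preserves the letters that the transducer
itself writes. -/
theorem fullRuns_substQueue (w : List (R ⊕ B)) (p : N.Q) (E : List (N.Entry R G)) :
    N.fullRuns ι' w (p, N.substQueue θ E) =
      (N.fullRuns ι w (p, E)).map fun r => (substLetters θ r.1, r.2) := by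
  induction w generalizing p E with
  | nil => cases E <;> simp [fullRuns_nil, substQueue, substLetters_id]
  | cons x w ih =>
    simp only [fullRuns_cons, N.step_substQueue hθ, Multiset.bind_map, ih, Multiset.map_bind,
      Multiset.map_map, Function.comp_def, substLetters_comp]

theorem outputs_substLetters (α : Assignment N.R G) (p : N.Q) :
    N.outputs ι' (substLetters θ α, p) = (N.outputs ι (α, p)).filterMap (subst θ) := by
  simp only [outputs, Multiset.filterMap_filterMap]
  congr 1
  funext f
  rw [subst_subst, subst_map, subst_map]
  congr 1
  funext x
  cases x with
  | inr c => simp [value, subst, hθ]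
  | inl X =>
    simp only [value, Sum.map_inl, Sum.elim_inl, Valuation.comp, substLetters, id,
      Option.bind_assoc]
    congr 1
    funext w
    simp only [extend_eq_subst, subst_subst]
    congr 1
    funext y
    cases y with
    | inl Z => simp [keep, value, subst, emptyValuation]
    | inr g =>
      cases h : θ g with
      | none => simp [keep, value, subst, h]
      | some u => simp [keep, value, subst, h, subst_map, subst_pure]

theorem outputsOn_substQueue (w : List (R ⊕ B)) (E : List (N.Entry R G)) :
    N.outputsOn ι' (N.substQueue θ E) w = (N.outputsOn ι E w).filterMap (subst θ) := by
  simp only [outputsOn, N.fullRuns_substQueue hθ, Multiset.bind_map, Multiset.filterMap_bind,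
    ← N.outputs_substLetters hθ]

end Naturality

theorem outputsOn_subst (ι : C → G) (σ : Assignment R B) (f : List (R ⊕ B))
    (E : List (N.Entry R G)) :
    ((subst (lift σ) f).elim 0 fun w => N.outputsOn ι E w) =
      (N.choices ι σ (regs f) E).bind fun E' => N.outputsOn ι E' f := by
  have := congrArg (fun s => s.bind (N.outputs ι)) (N.fullRuns_subst ι σ f N.q₀ E)
  simp only [Multiset.bind_assoc] at this
  simp only [outputsOn]
  rw [← this]
  cases subst (lift σ) f <;> simp

/-- The registers of the word have to match those in the queue. -/
theorem fullRuns_eq_zero (ι : C → G) (f : List (R ⊕ B)) (p : N.Q) (E : List (N.Entry R G))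
    (h : E.map Prod.fst ≠ regs f) : N.fullRuns ι f (p, E) = 0 := by
  induction f generalizing p E with
  | nil => cases E <;> simp_all [fullRuns_nil]
  | cons x f ih =>
    rw [fullRuns_cons]
    refine (Multiset.bind_congr (g := fun _ => 0) fun r hr => ?_).trans (Multiset.bind_zero _)
    obtain ⟨α, p', E'⟩ := r
    rw [ih, Multiset.map_zero]
    cases x with
    | inr b =>
      simp only [step, Multiset.mem_map] at hr
      obtain ⟨_, _, hr⟩ := hr
      simp_all
    | inl Y =>
      cases E with
      | nil => simp [step] at hr
      | cons e E =>
        simp only [step] at hr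
        split_ifs at hr with he
        · simp_all
        · simp at hr

theorem outputsOn_eq_zero (ι : C → G) (f : List (R ⊕ B)) (E : List (N.Entry R G))
    (h : E.map Prod.fst ≠ regs f) : N.outputsOn ι E f = 0 := by
  simp [outputsOn, N.fullRuns_eq_zero ι f _ E h]

/-- On words without registers the runs have the outputs of the transducer. -/
theorem outputsOn_map_inr (w : List B) :
    N.outputsOn (id : C → C) ([] : List (N.Entry R C)) (w.map .inr) = N.eval w := by
  have key : ∀ (w : List B) (p : N.Q) (α : Assignment N.R C),
      (N.fullRuns (id : C → C) (w.map Sum.inr) (p, ([] : List (N.Entry R C)))).bind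
        (fun r => N.outputs (id : C → C) (comp α r.1, r.2)) =
      (N.sym w p).filterMap (subst (value (emptyValuation.comp α))) := by
    intro w
    induction w with
    | nil => intro p α; simp [fullRuns_nil, sym, outputs]
    | cons b w ih =>
      intro p α
      have hid : ∀ σ : Assignment N.R C, mapLetters (id : C → C) σ = σ := fun σ => by
        funext X; simp [mapLetters]
      simp only [List.map_cons, fullRuns_cons, step, Multiset.bind_map, Multiset.bind_assoc, sym,
        Multiset.filterMap_bind, Multiset.filterMap_filterMap, ← comp_assoc, ih, hid, bind_subst_value,
        valuation_comp_comp]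
  have := key w N.q₀ idAssignment
  simpa [outputsOn, eval, valuation_comp_id] using this

end NSST

/-! ### Shapes and pieces of assignments -/

section Shapes

variable {R S G : Type*} [DecidableEq R]

/-- The letters before the first register of a word (for `none`) and between the first occurrence
of a register and the next register. -/
def piece : List (R ⊕ G) → Option R → List G
  | [], _ => []
  | .inr g :: w, none => g :: piece w none
  | .inr _ :: w, some Z => piece w (some Z)
  | .inl _ :: _, none => []
  | .inl X :: w, some Z => if Z = X then piece w none else piece w (some Z)

/-- Duplicates have to be excluded because `piece` only records the factor after the first
occurrence of a register. -/
theorem piece_decomposition (w : List (R ⊕ G)) (h : (regs w).Nodup) :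
    (piece w none).map .inr ++
      (regs w).flatMap (fun Z => .inl Z :: (piece w (some Z)).map .inr) = w := by
  induction w with
  | nil => rfl
  | cons x w ih =>
    cases x with
    | inr g =>
      simp only [piece, regs_inr, List.map_cons, List.cons_append]
      rw [ih h]
    | inl X =>
      simp only [regs_inl, List.nodup_cons] at h
      simp only [piece, List.map_nil, List.nil_append, regs_inl, List.flatMap_cons, if_true,
        List.cons_append]
      rw [List.flatMap_congr (g := fun Z => .inl Z :: (piece w (some Z)).map .inr), ih h.2]
      intro Z hZ
      rw [if_neg]
      rintro rfl
      exact h.1 hZ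

/-- The pieces are disjoint factors of w. Equality may fail, since letters after a repeated register
belong to no piece. -/
theorem sum_wt_piece_le [Fintype R] (V : G → ℕ) (w : List (R ⊕ G)) :
    ∑ o, wt V (piece w o) ≤ wt (Sum.elim 0 V) w := by
  induction w with
  | nil => simp [piece]
  | cons x w ih =>
    rw [Fintype.sum_option] at ih ⊢
    cases x with
    | inr g =>
      simp only [piece, wt_cons, Sum.elim_inr]
      omega
    | inl X =>
      simp only [piece, wt_nil, wt_cons, Sum.elim_inl, Pi.zero_apply, zero_add]
      refine le_trans ?_ ih
      rw [← Finset.add_sum_erase _ _ (Finset.mem_univ X), if_pos rfl]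
      refine Nat.add_le_add_left ?_ _
      rw [← Finset.add_sum_erase _ (fun Z => wt V (piece w (some Z))) (Finset.mem_univ X)]
      refine le_trans (Finset.sum_le_sum fun Z hZ => ?_) (Nat.le_add_left _ _)
      rw [if_neg (Finset.ne_of_mem_erase hZ)]

/-- The orders of registers in the right-hand sides of a copyless assignment. -/
abbrev Shape (R : Type*) [Fintype R] [DecidableEq R] : Type _ :=
  {s : R → Option (List R) // ∀ Z, ∑ X, ((s X).getD []).count Z ≤ 1}

variable [Fintype R]

/-- A right-hand side is either undefined or a duplicate-free list over a finite set; the Boolean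
distinguishes undefined from empty. -/
instance : Finite (Shape R) := by
  have hn : ∀ (s : Shape R) X, ((s.1 X).getD []).Nodup := fun s X =>
    List.nodup_iff_count_le_one.2 fun Z =>
      (Finset.single_le_sum (f := fun X => ((s.1 X).getD []).count Z)
        (fun _ _ => Nat.zero_le _) (Finset.mem_univ X)).trans (s.2 Z)
  refine Finite.of_injective (β := R → Bool × {l : List R // l.Nodup})
    (fun s X => ((s.1 X).isSome, ⟨(s.1 X).getD [], hn s X⟩)) fun s s' h => Subtype.ext ?_
  funext X
  have h1 := congrFun h X
  simp only [Prod.mk.injEq, Subtype.mk.injEq] at h1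
  cases h2 : s.1 X <;> cases h3 : s'.1 X <;> simp_all

theorem getD_map_regs (o : Option (List (R ⊕ G))) : (o.map regs).getD [] = regs (o.getD []) := by
  cases o <;> rfl

/-- The shape of an assignment; it is meaningful for copyless assignments. -/
noncomputable def shape (α : Assignment R G) : Shape R :=
  if h : ∀ Z, ∑ X, (((α X).map regs).getD []).count Z ≤ 1 then ⟨fun X => (α X).map regs, h⟩
  else ⟨fun _ => none, by simp⟩

theorem shape_val {α : Assignment R G} (h : α.Copyless) : (shape α).1 = fun X => (α X).map regs := by
  rw [shape, dif_pos]
  intro Z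
  simpa only [getD_map_regs, count_regs] using h Z

/-- The assignment of a given shape in which the pieces are registers. -/
def genericAssignment {S : Type*} (Y : S) (s : Shape R) :
    Assignment R ((S × R × Option R) ⊕ G) :=
  fun X => (s.1 X).map fun l => .inr (.inl (Y, X, none)) ::
    l.flatMap fun Z => [.inl Z, .inr (.inl (Y, X, some Z))]

theorem wt_flatMap {L M : Type*} (ω : M → ℕ) (f : L → List M) (l : List L) :
    wt ω (l.flatMap f) = (l.map fun x => wt ω (f x)).sum := by
  induction l with
  | nil => rfl
  | cons x l ih => simp [ih]

theorem genericAssignment_copyless {S : Type*} (Y : S) (s : Shape R) :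
    (genericAssignment Y s : Assignment R ((S × R × Option R) ⊕ G)).Copyless := by
  intro Z
  refine le_trans (Finset.sum_le_sum fun X _ => ?_) (s.2 Z)
  cases h : s.1 X with
  | none => simp [genericAssignment, h]
  | some l =>
    simp only [genericAssignment, h, Option.map_some, Option.getD_some, List.countP_cons,
      ← count_regs]
    clear h
    induction l with
    | nil => simp
    | cons W l ih => simp_all [List.count_cons]

/-- The register `(Y, X, o)` occurs only in the right-hand side of X in the entry of Y, and for `o =
some Z` only right after Z, which itself occurs at most once. -/
theorem totalWt_genericAssignment_le {S : Type*} [DecidableEq S] (Y : S) (s : Shape R)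
    (r : S × R × Option R) :
    totalWt 0 (Sum.elim (fun r' => if r' = r then 1 else 0) 0)
      (genericAssignment Y s : Assignment R ((S × R × Option R) ⊕ G)) ≤
      if Y = r.1 then 1 else 0 := by
  obtain ⟨Y', X', o⟩ := r
  have key : ∀ X, wt (Sum.elim 0 (Sum.elim (fun r' => if r' = (Y', X', o) then 1 else 0) 0))
      (((genericAssignment Y s : Assignment R ((S × R × Option R) ⊕ G)) X).getD []) ≤
      if X = X' then (if Y = Y' then 1 else 0) else 0 := by
    intro X
    have hs : ((s.1 X).getD []).count ≤ 1 := fun Z =>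
      (Finset.single_le_sum (f := fun X => ((s.1 X).getD []).count Z)
        (fun _ _ => Nat.zero_le _) (Finset.mem_univ X)).trans (s.2 Z)
    cases h : s.1 X with
    | none => simp [genericAssignment, h]
    | some l =>
      simp only [h, Option.getD_some] at hs
      have hl : ∀ l : List R, ((l.map fun Z =>
          if (Y, X, some Z) = (Y', X', o) then 1 else 0).sum : ℕ) =
          if Y = Y' ∧ X = X' then o.elim 0 (fun Z => l.count Z) else 0 := by
        intro l
        induction l with
        | nil => cases o <;> simp
        | cons W l ih =>
          rw [List.map_cons, List.sum_cons, ih]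
          by_cases hY : Y = Y' <;> by_cases hX : X = X' <;> cases o <;>
            simp [hY, hX, List.count_cons, add_comm]
      simp only [genericAssignment, h, Option.map_some, Option.getD_some, wt_cons, wt_flatMap,
        Sum.elim_inl, Sum.elim_inr, wt_nil, Pi.zero_apply, add_zero, zero_add, hl]
      by_cases hY : Y = Y' <;> by_cases hX : X = X' <;> cases o <;> simp [hY, hX]
      exact hs _
  refine (Finset.sum_le_sum fun X _ => key X).trans ?_
  simp

end Shapes

/-! ### Queues as finite shapes with pieces in registers -/

namespace NSST

variable {B C : Type*} (N : NSST B C) {S G : Type*} [DecidableEq S]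

/-- The registers that hold the pieces of the assignments in a queue. -/
abbrev PieceReg (S : Type*) : Type _ := S × N.R × Option N.R

/-- The assignment of the pieces of the assignments in a queue to registers. -/
def pieceAssignment (E : List (N.Entry S (N.PieceReg S ⊕ C))) : Assignment (N.PieceReg S) C :=
  fun r => some (E.flatMap fun e => if e.1 = r.1 then piece ((e.2.2.2 r.2.1).getD []) r.2.2 else [])

/-- Finite descriptions of queues. -/
abbrev QueueShape (S : Type*) : Type _ :=
  {g : List (S × N.Q × N.Q × Shape N.R) // (g.map Prod.fst).Nodup}

instance [Finite S] : Finite (N.QueueShape S) := by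
  have := Fintype.ofFinite S
  refine Set.Finite.subset
    (List.finite_length_le (S × N.Q × N.Q × Shape N.R) (Fintype.card S)) fun g hg => ?_
  simpa using List.Nodup.length_le_card hg

/-- The shape of a queue. -/
noncomputable def queueShape (E : List (N.Entry S G)) : N.QueueShape S :=
  if h : (E.map Prod.fst).Nodup then
    ⟨E.map fun e => (e.1, e.2.1, e.2.2.1, shape e.2.2.2), by simpa [Function.comp_def] using h⟩
  else ⟨[], by simp⟩

/-- The queue of a given shape in which the pieces are registers. -/
def genericQueue (g : N.QueueShape S) : List (N.Entry S (N.PieceReg S ⊕ C)) :=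
  g.1.map fun e => (e.1, e.2.1, e.2.2.1, genericAssignment e.1 e.2.2.2)

/-- Putting the pieces back between the registers restores the assignment, by `piece_decomposition`.
As no other entry of the queue has the register of `e`, the piece registers of `e` hold pieces of
`e` only. -/
theorem substLetters_genericAssignment (E : List (N.Entry S (N.PieceReg S ⊕ C)))
    (h : (E.map Prod.fst).Nodup) {e : N.Entry S (N.PieceReg S ⊕ C)} (he : e ∈ E)
    (hc : e.2.2.2.Copyless) :
    substLetters (lift (N.pieceAssignment E)) (genericAssignment e.1 (shape e.2.2.2)) =
      e.2.2.2 := by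
  have hp : ∀ X o, N.pieceAssignment E (e.1, X, o) = some (piece ((e.2.2.2 X).getD []) o) := by
    intro X o
    have key : ∀ E : List (N.Entry S (N.PieceReg S ⊕ C)), (E.map Prod.fst).Nodup → e ∈ E →
        E.flatMap (fun e' => if e'.1 = e.1 then piece ((e'.2.2.2 X).getD []) o else []) =
          piece ((e.2.2.2 X).getD []) o := by
      intro E hE heE
      induction E with
      | nil => simp at heE
      | cons e' E ih =>
        rw [List.map_cons, List.nodup_cons] at hE
        rw [List.flatMap_cons]
        rcases List.mem_cons.1 heE with rfl | heE
        · rw [if_pos rfl, List.flatMap_eq_nil_iff.2, List.append_nil]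
          intro e' he'
          rw [if_neg]
          intro h'
          exact hE.1 (h' ▸ List.mem_map_of_mem he')
        · rw [ih hE.2 heE, if_neg, List.nil_append]
          intro h'
          exact hE.1 (h' ▸ List.mem_map_of_mem heE)
    simp only [pieceAssignment]
    rw [key E h he]
  funext X
  simp only [substLetters, genericAssignment, shape_val hc]
  have hn : (regs ((e.2.2.2 X).getD [])).Nodup := List.nodup_iff_count_le_one.2 fun Z => by
    rw [count_regs]
    exact (Finset.single_le_sum (f := fun X => ((e.2.2.2 X).getD []).countP
      (fun c => c.getLeft? = some Z)) (fun _ _ => Nat.zero_le _) (Finset.mem_univ X)).trans (hc Z)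
  cases hX : e.2.2.2 X with
  | none => rfl
  | some w =>
    simp only [hX, Option.getD_some] at hn
    have hfl : ∀ l : List N.R, subst (keep (lift (N.pieceAssignment E)))
        (l.flatMap fun Z => [.inl Z, .inr (.inl (e.1, X, some Z))]) =
          some (l.flatMap fun Z => .inl Z :: (piece w (some Z)).map .inr) := by
      intro l
      induction l with
      | nil => rfl
      | cons Z l ih =>
        rw [List.flatMap_cons, subst_append, ih]
        simp [subst, keep, lift, hp, hX]
    conv_rhs => rw [← piece_decomposition w hn]
    simp only [Option.map_some, Option.bind_some, subst, hfl]
    simp [keep, lift, hp, hX]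

/-- Combined with naturality, this allows the composite to compute with the generic queue of its
state and to insert the actual pieces afterwards. -/
theorem substQueue_genericQueue (E : List (N.Entry S (N.PieceReg S ⊕ C)))
    (h : (E.map Prod.fst).Nodup) (hc : ∀ e ∈ E, e.2.2.2.Copyless) :
    N.substQueue (lift (N.pieceAssignment E)) (N.genericQueue (N.queueShape E)) = E := by
  rw [queueShape, dif_pos h]
  simp only [substQueue, genericQueue, List.map_map]
  conv_rhs => rw [← List.map_id E]
  refine List.map_congr_left fun e he => ?_
  simp [N.substLetters_genericAssignment E h he (hc e he)]

/-! ### Weights of runs -/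

/-- The total weight of the letters in a queue. -/
def queueWt {G : Type*} (V : G → ℕ) (E : List (N.Entry S G)) : ℕ :=
  (E.map fun e => totalWt 0 V e.2.2.2).sum

section Weights

variable {ι : C → G} {V : G → ℕ}

theorem mapLetters_copyless {R : Type*} [Fintype R] [DecidableEq R] {σ : Assignment R C}
    (h : σ.Copyless) : (mapLetters ι σ).Copyless := by
  intro Z
  refine le_of_eq_of_le (Finset.sum_congr rfl fun X _ => ?_) (h Z)
  cases hX : σ X with
  | none => simp [mapLetters, hX]
  | some w =>
    simp only [mapLetters, hX, Option.map_some, Option.getD_some, List.countP_map]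
    congr 1
    funext x
    cases x <;> simp

theorem totalWt_mapLetters {R : Type*} [Fintype R] [DecidableEq R] (hV : ∀ c, V (ι c) = 0)
    (σ : Assignment R C) : totalWt 0 V (mapLetters ι σ) = 0 := by
  refine Finset.sum_eq_zero fun X _ => ?_
  cases hX : σ X with
  | none => simp [mapLetters, hX]
  | some w =>
    simp only [mapLetters, hX, Option.map_some, Option.getD_some, wt_map]
    have : (fun x => Sum.elim (0 : R → ℕ) V (Sum.map id ι x)) = fun _ : R ⊕ C => 0 := by
      funext x; cases x <;> simp [hV]
    rw [this]
    simp [wt]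

/-- A step either consumes an entry, whose letters move from the queue to the assignment, or takes a
transition, whose letters have weight zero. So weight is passed on or lost when a register is
dropped, but never multiplied. -/
theorem runs_spec (w : List (S ⊕ B)) (p : N.Q) (E : List (N.Entry S G))
    (hE : ∀ e ∈ E, e.2.2.2.Copyless) :
    ∀ r ∈ N.runs ι w (p, E), r.1.Copyless ∧ (∀ e ∈ r.2.2, e.2.2.2.Copyless) ∧
      ((∀ c, V (ι c) = 0) → totalWt 0 V r.1 + N.queueWt V r.2.2 ≤ N.queueWt V E) := by
  induction w generalizing p E with
  | nil =>
    simp only [runs, Multiset.mem_singleton, forall_eq]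
    exact ⟨copyless_id, hE, fun _ => by simp [totalWt_id]⟩
  | cons x w ih =>
    simp only [runs, Multiset.mem_bind, Multiset.mem_map]
    rintro _ ⟨⟨α, p', E'⟩, hs, r, hr, rfl⟩
    have hs' : α.Copyless ∧ (∀ e ∈ E', e.2.2.2.Copyless) ∧
        ((∀ c, V (ι c) = 0) → totalWt 0 V α + N.queueWt V E' ≤ N.queueWt V E) := by
      cases x with
      | inr b =>
        simp only [step, Multiset.mem_map, Prod.mk.injEq] at hs
        obtain ⟨t, ht, rfl, rfl, rfl⟩ := hs
        refine ⟨mapLetters_copyless (N.copyless p b t ht), hE, fun hV => ?_⟩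
        rw [totalWt_mapLetters hV, zero_add]
      | inl Y =>
        cases E with
        | nil => simp [step] at hs
        | cons e E =>
          simp only [step] at hs
          split_ifs at hs
          · simp only [Multiset.mem_singleton, Prod.mk.injEq] at hs
            obtain ⟨rfl, rfl, rfl⟩ := hs
            exact ⟨hE _ (by simp), fun e' he' => hE e' (by simp [he']), fun _ => by simp [queueWt]⟩
          · simp at hs
    obtain ⟨h1, h2, h3⟩ := ih p' E' hs'.2.1 r hr
    refine ⟨hs'.1.comp h1, h2, fun hV => ?_⟩
    have := totalWt_comp_le α h1 0 V
    have := h3 hV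
    have := hs'.2.2 hV
    dsimp only at *
    omega

theorem choices_spec (σ : Assignment S B) (ys : List S) (E : List (N.Entry S G))
    (hE : ∀ e ∈ E, e.2.2.2.Copyless) :
    ∀ E' ∈ N.choices ι σ ys E, E'.map Prod.fst = ys ∧ (∀ e ∈ E', e.2.2.2.Copyless) ∧
      ((∀ c, V (ι c) = 0) → N.queueWt V E' ≤ N.queueWt V E) := by
  induction ys generalizing E with
  | nil => cases E <;> simp [choices]
  | cons Y ys ih =>
    simp only [choices, Multiset.mem_bind, Multiset.mem_map]
    rintro _ ⟨p, -, r, hr, E', hE', rfl⟩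
    cases hY : σ Y with
    | none => simp [hY] at hr
    | some w =>
      rw [hY] at hr
      obtain ⟨h1, h2, h3⟩ := N.runs_spec (V := V) w p E hE r hr
      obtain ⟨h4, h5, h6⟩ := ih r.2.2 h2 E' hE'
      refine ⟨by simp [h4], List.forall_mem_cons.2 ⟨h1, h5⟩, fun hV => ?_⟩
      refine le_trans ?_ (h3 hV)
      simpa [queueWt] using h6 hV

theorem wt_le_of_mem_outputsOn (hV : ∀ c, V (ι c) = 0) (w : List (S ⊕ B))
    (E : List (N.Entry S G)) (hE : ∀ e ∈ E, e.2.2.2.Copyless) :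
    ∀ v ∈ N.outputsOn ι E w, wt V v ≤ N.queueWt V E := by
  intro v hv
  simp only [outputsOn, fullRuns, outputs, Multiset.mem_bind, Multiset.mem_filterMap] at hv
  obtain ⟨⟨α, p⟩, ⟨⟨α', p', E'⟩, hr, hf⟩, f, hf', hv⟩ := hv
  obtain ⟨h1, -, h3⟩ := N.runs_spec (V := V) w N.q₀ E hE _ hr
  cases E' with
  | cons => simp [finished] at hf
  | nil =>
    simp only [finished, Option.some.injEq, Prod.mk.injEq] at hf
    obtain ⟨rfl, rfl⟩ := hf
    refine le_trans ?_ (h3 hV)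
    rw [subst_map] at hv
    rw [wt_subst V hv]
    set W : N.R → ℕ := fun X => wt (Sum.elim 0 V) ((α' X).getD []) with hW
    refine le_trans (wt_mono (ω' := Sum.elim W 0) (fun x => ?_) f) ?_
    · cases x with
      | inr c => simp [value, hV]
      | inl X =>
        simp only [Sum.map_inl, id, value, Sum.elim_inl, Valuation.comp, hW]
        cases hX : α' X with
        | none => simp
        | some u =>
          simp only [Option.bind_some, extend_eq_subst, Option.getD_some]
          refine (wt_getD_subst_le _ _ _).trans (wt_mono (fun y => ?_) _)
          cases y <;> simp [value, emptyValuation]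
    · rw [wt_sum_elim]
      have h0 : (Sum.elim 0 0 : N.R ⊕ C → ℕ) = fun _ => 0 := by funext x; cases x <;> rfl
      simp only [h0, wt, List.map_const', List.sum_replicate, smul_zero, add_zero]
      refine le_trans (Finset.sum_le_sum fun X _ =>
        (Nat.mul_le_mul_right _ (N.final_once _ f hf' X)).trans (one_mul _).le) ?_
      simp [hW, totalWt]

end Weights

/-- The weight that counts the occurrences of a register. -/
def indicator {R C : Type*} [DecidableEq R] (r : R) : R ⊕ C → ℕ :=
  Sum.elim (fun r' => if r' = r then 1 else 0) 0

theorem queueWt_genericQueue_le (g : N.QueueShape S) (r : N.PieceReg S) :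
    N.queueWt (indicator r) (N.genericQueue g) ≤ 1 := by
  obtain ⟨g, hg⟩ := g
  simp only [queueWt, genericQueue, List.map_map, Function.comp_def]
  refine (List.sum_le_sum (g := fun e => if e.1 = r.1 then 1 else 0)
    fun e _ => totalWt_genericAssignment_le e.1 e.2.2.2 r).trans ?_
  have := List.nodup_iff_count_le_one.1 hg r.1
  refine le_of_eq_of_le ?_ this
  clear this hg
  induction g with
  | nil => rfl
  | cons e g ih => simp_all [List.count_cons, add_comm]

theorem genericQueue_copyless (g : N.QueueShape S) :
    ∀ e ∈ (N.genericQueue g : List (N.Entry S (N.PieceReg S ⊕ C))), e.2.2.2.Copyless := by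
  simp only [genericQueue, List.mem_map]
  rintro _ ⟨e, _, rfl⟩
  exact genericAssignment_copyless _ _

/-- An entry of Y contributes only to the registers `(Y, X, o)`, and its pieces are disjoint
factors, so no occurrence of a register in the queue is used twice. -/
theorem pieceAssignment_copyless [Fintype S] (E : List (N.Entry S (N.PieceReg S ⊕ C)))
    (h : ∀ r : N.PieceReg S, N.queueWt (indicator r) E ≤ 1) :
    (N.pieceAssignment E).Copyless := by
  rw [copyless_iff_totalWt]
  intro r
  refine le_trans ?_ (h r)
  change totalWt _ _ _ ≤ _
  have : (Sum.elim (fun Y => if Y = r then 1 else 0) 0 : N.PieceReg S ⊕ C → ℕ) = indicator r := rfl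
  simp only [totalWt, this, pieceAssignment, Option.getD_some, wt_flatMap, Fintype.sum_prod_type,
    queueWt]
  clear h
  induction E with
  | nil => simp
  | cons e E ih =>
    simp only [List.map_cons, List.sum_cons, Finset.sum_add_distrib]
    refine Nat.add_le_add ?_ ih
    rw [Finset.sum_eq_single e.1]
    · refine Finset.sum_le_sum fun X _ => ?_
      simpa using sum_wt_piece_le (indicator r) ((e.2.2.2 X).getD [])
    · intro Y _ hY
      simp [Ne.symm hY]
    · simp

end NSST

namespace NSST

/-! ### Bags of initial configurations -/

section Init

variable {A B : Type*} (N : NSST A B)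

/-- The transducer that starts in any of the given states, after any of the given assignments. -/
@[reducible] def withInit (I : Multiset (Assignment N.R B × N.Q)) (hI : ∀ p ∈ I, p.1.Copyless) : NSST A B where
  Q := Option N.Q
  R := N.R
  δ q a := q.elim (I.bind fun p => (N.δ p.2 a).map fun r => (comp p.1 r.1, some r.2))
    fun q => (N.δ q a).map fun r => (r.1, some r.2)
  copyless q a := by
    cases q with
    | none =>
      simp only [Option.elim_none, Multiset.mem_bind, Multiset.mem_map]
      rintro _ ⟨p, hp, r, hr, rfl⟩
      exact (hI p hp).comp (N.copyless _ _ r hr)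
    | some q =>
      simp only [Option.elim_some, Multiset.mem_map]
      rintro _ ⟨r, hr, rfl⟩
      exact N.copyless _ _ r hr
  q₀ := none
  F q := q.elim (I.bind fun p => (N.F p.2).filterMap (subst (lift p.1))) N.F
  final_once q := by
    cases q with
    | none =>
      simp only [Option.elim_none, Multiset.mem_bind, Multiset.mem_filterMap]
      rintro v ⟨p, hp, w, hw, hv⟩
      exact countP_subst_lift_le (hI p hp) (N.final_once _ w hw) hv
    | some q => exact N.final_once q

/-- An `NSST` has a single initial state, whereas the composite starts with a guess. The guess is
merged into the first transition, or into the final words if the input is empty. -/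
theorem eval_withInit (I : Multiset (Assignment N.R B × N.Q)) (hI : ∀ p ∈ I, p.1.Copyless)
    (w : List A) : (N.withInit I hI).eval w =
      (I.bind fun p => (N.sym w p.2).filterMap (subst (lift p.1))).filterMap
        (subst (value emptyValuation)) := by
  have h1 : ∀ (w : List A) (q : N.Q), (N.withInit I hI).sym w (some q) = N.sym w q := by
    intro w
    induction w with
    | nil => intro q; rfl
    | cons a w ih =>
      intro q
      simp only [sym]
      change (((N.δ q a).map _).bind _) = _
      rw [Multiset.bind_map]
      exact Multiset.bind_congr fun r _ => by rw [ih]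
  unfold eval
  refine congrArg (Multiset.filterMap _) ?_
  cases w with
  | nil => rfl
  | cons a w =>
    simp only [sym]
    change ((I.bind _).bind _) = _
    rw [Multiset.bind_assoc]
    refine Multiset.bind_congr fun p _ => ?_
    rw [Multiset.bind_map, Multiset.filterMap_bind]
    refine Multiset.bind_congr fun r _ => ?_
    rw [h1, Multiset.filterMap_filterMap]
    congr 1
    funext u
    exact (bind_subst_lift _ _ _).symm

end Init

/-! ### Composition of nondeterministic streaming string transducers -/

section Comp

variable {A B C : Type*} (N₁ : NSST A B) (N₂ : NSST B C)

/-- The configurations after a transition of the first transducer. -/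
noncomputable def successors (σ : Assignment N₁.R B) (q : N₁.Q)
    (E : List (N₂.Entry N₁.R (N₂.PieceReg N₁.R ⊕ C))) :
    Multiset (Assignment (N₂.PieceReg N₁.R) C × N₁.Q × N₂.QueueShape N₁.R) :=
  (univBag {l : List N₁.R // l.Nodup}).bind fun ys =>
    (N₂.choices .inr σ ys.1 E).map fun E' => (N₂.pieceAssignment E', q, N₂.queueShape E')

theorem successors_copyless (σ : Assignment N₁.R B) (q : N₁.Q)
    (E : List (N₂.Entry N₁.R (N₂.PieceReg N₁.R ⊕ C))) (hE : ∀ e ∈ E, e.2.2.2.Copyless)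
    (hw : ∀ r : N₂.PieceReg N₁.R, N₂.queueWt (indicator r) E ≤ 1) :
    ∀ p ∈ N₁.successors N₂ σ q E, p.1.Copyless := by
  simp only [successors, Multiset.mem_bind, Multiset.mem_map]
  rintro _ ⟨ys, -, E', hE', rfl⟩
  refine N₂.pieceAssignment_copyless E' fun r => ?_
  exact ((N₂.choices_spec σ ys.1 E hE E' hE').2.2 fun _ => rfl).trans (hw r)

/-- The transducer that guesses runs of `N₂` on the register contents of `N₁`. -/
@[reducible] noncomputable def guess : NSST A C where
  Q := N₁.Q × N₂.QueueShape N₁.R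
  R := N₂.PieceReg N₁.R
  δ s a := (N₁.δ s.1 a).bind fun p => N₁.successors N₂ p.1 p.2 (N₂.genericQueue s.2)
  copyless s a := by
    simp only [Multiset.mem_bind]
    rintro p ⟨r, _, hp⟩
    exact N₁.successors_copyless N₂ _ _ _ (N₂.genericQueue_copyless _)
      (N₂.queueWt_genericQueue_le _) p hp
  q₀ := (N₁.q₀, ⟨[], by simp⟩)
  F s := (N₁.F s.1).bind fun f => N₂.outputsOn .inr (N₂.genericQueue s.2) f
  final_once s := by
    simp only [Multiset.mem_bind]
    rintro v ⟨f, _, hv⟩ X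
    rw [← wt_indicator_eq_countP]
    exact (N₂.wt_le_of_mem_outputsOn (V := indicator X) (ι := .inr) (fun _ => rfl) f _ (N₂.genericQueue_copyless _) v hv).trans
      (N₂.queueWt_genericQueue_le _ X)

/-- The inductive step of the simulation. Each guessed queue E' is stored as shape and pieces and
recovered by naturality; summed over all E', `outputsOn_subst` reassembles the runs on σ(f). Only
the guess `ys = regs f` contributes. -/
theorem bind_successors (w : List A) (q : N₁.Q)
    (h : ∀ g, (N₁.guess N₂).sym w (q, g) =
      (N₁.sym w q).bind fun f => N₂.outputsOn .inr (N₂.genericQueue g) f)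
    (σ : Assignment N₁.R B) (E : List (N₂.Entry N₁.R (N₂.PieceReg N₁.R ⊕ C)))
    (hE : ∀ e ∈ E, e.2.2.2.Copyless) :
    ((N₁.successors N₂ σ q E).bind fun p =>
        ((N₁.guess N₂).sym w p.2).filterMap (subst (lift p.1))) =
      ((N₁.sym w q).filterMap (subst (lift σ))).bind fun f => N₂.outputsOn .inr E f := by
  have h1 : ∀ (ys : {l : List N₁.R // l.Nodup}), ∀ E' ∈ N₂.choices .inr σ ys.1 E,
      ((N₁.guess N₂).sym w (q, N₂.queueShape E')).filterMap (subst (lift (N₂.pieceAssignment E'))) =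
        (N₁.sym w q).bind fun f => N₂.outputsOn .inr E' f := by
    intro ys E' hE'
    obtain ⟨h1, h2, -⟩ := N₂.choices_spec (V := fun _ => 0) σ ys.1 E hE E' hE'
    rw [h, Multiset.filterMap_bind]
    refine Multiset.bind_congr fun f _ => ?_
    rw [← N₂.outputsOn_substQueue (ι := .inr) (ι' := .inr)
      (θ := lift (N₂.pieceAssignment E')) (fun _ => rfl),
      N₂.substQueue_genericQueue E' (h1 ▸ ys.2) h2]
  simp only [successors, Multiset.bind_assoc, Multiset.bind_map]
  rw [Multiset.bind_congr fun ys _ => Multiset.bind_congr (h1 ys),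
    Multiset.bind_congr fun ys _ => Multiset.bind_bind _ _, Multiset.bind_bind,
    Multiset.bind_filterMap]
  refine Multiset.bind_congr fun f hf => ?_
  have hn : (regs f).Nodup := List.nodup_iff_count_le_one.2 fun X => by
    rw [count_regs]
    exact N₁.countP_le_one_of_mem_sym w q f hf X
  rw [bind_eq_of_nodup (nodup_univBag _) (mem_univBag ⟨regs f, hn⟩), ← N₂.outputsOn_subst]
  · cases subst (lift σ) f <;> rfl
  · intro ys _ hys
    refine (Multiset.bind_congr (g := fun _ => 0) fun E' hE' => ?_).trans (Multiset.bind_zero _)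
    refine N₂.outputsOn_eq_zero _ _ _ fun h' => hys (Subtype.ext ?_)
    rw [← (N₂.choices_spec (V := fun _ => 0) σ ys.1 E hE E' hE').1, h']

/-- The invariant of the composition. Both sides are words over the piece registers, with arbitrary
contents, which is what makes induction on the remaining input possible. -/
theorem sym_guess (w : List A) (q : N₁.Q) (g : N₂.QueueShape N₁.R) :
    (N₁.guess N₂).sym w (q, g) =
      (N₁.sym w q).bind fun f => N₂.outputsOn .inr (N₂.genericQueue g) f := by
  induction w generalizing q g with
  | nil => rfl
  | cons a w ih =>
    simp only [sym]
    rw [Multiset.bind_assoc, Multiset.bind_assoc]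
    refine Multiset.bind_congr fun p _ => ?_
    exact N₁.bind_successors N₂ w p.2 (ih p.2) p.1 _ (N₂.genericQueue_copyless g)

theorem exists_comp : ∃ N : NSST A C, ∀ w, N.eval w = (N₁.eval w).bind N₂.eval := by
  -- The initial valuation is viewed as an assignment of empty words preceded by the empty queue, so
  -- the initial guess is handled like any transition.
  have hI := N₁.successors_copyless N₂ (fun _ => some []) N₁.q₀ [] (by simp) (by simp [queueWt])
  refine ⟨(N₁.guess N₂).withInit _ hI, fun w => ?_⟩
  rw [eval_withInit, bind_successors N₁ N₂ w N₁.q₀ (N₁.sym_guess N₂ w N₁.q₀) _ _ (by simp),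
    Multiset.filterMap_bind, eval, Multiset.bind_filterMap, Multiset.bind_filterMap]
  refine Multiset.bind_congr fun f _ => ?_
  have h : subst (lift (fun _ => some [])) f =
      (subst (value emptyValuation) f).map (List.map Sum.inr) := by
    rw [Option.map_eq_bind, show (some ∘ List.map (Sum.inr : B → N₁.R ⊕ B)) =
      subst (fun b => some [Sum.inr b]) from funext fun u => (subst_some_map _ u).symm]
    rw [subst_subst]
    congr 1
    funext x
    cases x <;> rfl
  rw [h]
  cases subst (value emptyValuation) f with
  | none => rfl
  | some u =>
    simp only [Option.map_some, Option.getD_some]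
    rw [← N₂.outputsOn_map_inr (R := N₁.R) u]
    exact (N₂.outputsOn_substQueue (ι := .inr) (ι' := id) (θ := value emptyValuation)
      (fun _ => rfl) _ []).symm

end Comp

end NSST

/-! ### Spans and labels of multiref-words -/

section Spans

variable {A X : Type*} [DecidableEq X]

/-- The next bracket of `x` in the word is a closing one, at position `j` of the document. -/
def NextCls (x : X) : List (RefSym A X) → ℕ → Prop
  | [], _ => False
  | .letter _ :: _, 0 => False
  | .letter _ :: w, j + 1 => NextCls x w j
  | .opn y :: w, j => y ≠ x ∧ NextCls x w j
  | .cls y :: w, j => if y = x then j = 0 else NextCls x w j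

/-- A recursive description of the spans of `x` in a word. -/
def SpanAt (x : X) : List (RefSym A X) → ℕ → ℕ → Prop
  | [], _, _ => False
  | .letter _ :: w, i + 1, j + 1 => SpanAt x w i j
  | .letter _ :: _, _, _ => False
  | .opn y :: w, i, j => SpanAt x w i j ∨ (y = x ∧ i = 0 ∧ NextCls x w j)
  | .cls _ :: w, i, j => SpanAt x w i j

theorem nextCls_iff (x : X) (w : List (RefSym A X)) (j : ℕ) :
    NextCls x w j ↔ ∃ v z, w = v ++ RefSym.cls x :: z ∧
      RefSym.opn x ∉ v ∧ RefSym.cls x ∉ v ∧ j = (doc v).length := by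
  constructor
  · intro h
    induction w generalizing j with
    | nil => exact h.elim
    | cons c w ih =>
      cases c with
      | letter a =>
        cases j with
        | zero => exact h.elim
        | succ j =>
          obtain ⟨v, z, rfl, h1, h2, rfl⟩ := ih j h
          exact ⟨.letter a :: v, z, rfl, by simpa using h1, by simpa using h2, rfl⟩
      | opn y =>
        obtain ⟨hy, h⟩ := h
        obtain ⟨v, z, rfl, h1, h2, rfl⟩ := ih j h
        exact ⟨.opn y :: v, z, rfl, by simpa using ⟨hy.symm, h1⟩, by simpa using h2, rfl⟩
      | cls y =>
        by_cases hy : y = x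
        · subst hy
          simp only [NextCls, if_true] at h
          exact ⟨[], w, rfl, by simp, by simp, h⟩
        · simp only [NextCls, if_neg hy] at h
          obtain ⟨v, z, rfl, h1, h2, rfl⟩ := ih j h
          exact ⟨.cls y :: v, z, rfl, by simpa using h1, by simpa using ⟨Ne.symm hy, h2⟩, rfl⟩
  · rintro ⟨v, z, rfl, h1, h2, rfl⟩
    induction v with
    | nil => simp [NextCls, doc]
    | cons c v ih =>
      simp only [List.mem_cons, not_or] at h1 h2
      specialize ih h1.2 h2.2
      cases c with
      | letter a => exact ih
      | opn y => exact ⟨fun h => h1.1 (h ▸ rfl), ih⟩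
      | cls y =>
        have hy : y ≠ x := fun h => h2.1 (h ▸ rfl)
        simpa [NextCls, hy, doc] using ih

theorem hasSpan_cons (x : X) (c : RefSym A X) (w : List (RefSym A X)) (i j : ℕ) :
    HasSpan (c :: w) x i j ↔ (c = .opn x ∧ i = 0 ∧ NextCls x w j) ∨
      ∃ i' j', HasSpan w x i' j' ∧ i = (doc [c]).length + i' ∧ j = (doc [c]).length + j' := by
  have hdoc : ∀ u : List (RefSym A X), (doc (c :: u)).length = (doc [c]).length + (doc u).length := by
    intro u
    cases c <;> simp [doc, add_comm]
  rw [nextCls_iff]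
  constructor
  · rintro ⟨u, v, z, h, h1, h2, rfl, rfl⟩
    cases u with
    | nil =>
      simp only [List.nil_append, List.cons_append, List.cons.injEq,
        List.append_assoc] at h
      exact .inl ⟨h.1, rfl, v, z, h.2, h1, h2, by simp [doc]⟩
    | cons c' u =>
      simp only [List.cons_append, List.cons.injEq] at h
      obtain ⟨rfl, h⟩ := h
      exact .inr ⟨_, _, ⟨u, v, z, h, h1, h2, rfl, rfl⟩, hdoc u, by rw [hdoc u, add_assoc]⟩
  · rintro (⟨rfl, rfl, v, z, rfl, h1, h2, rfl⟩ | ⟨_, _, ⟨u, v, z, rfl, h1, h2, rfl, rfl⟩, rfl, rfl⟩)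
    · exact ⟨[], v, z, by simp, h1, h2, rfl, by simp [doc]⟩
    · exact ⟨c :: u, v, z, rfl, h1, h2, (hdoc u).symm, by rw [hdoc u, add_assoc]⟩

/-- Replaces the factorizations in `HasSpan` by a predicate suited to induction along the word. -/
theorem hasSpan_iff_spanAt (x : X) (w : List (RefSym A X)) (i j : ℕ) :
    HasSpan w x i j ↔ SpanAt x w i j := by
  induction w generalizing i j with
  | nil => simp [HasSpan, SpanAt]
  | cons c w ih =>
    rw [hasSpan_cons]
    simp only [ih]
    cases c with
    | letter a =>
      cases i <;> cases j <;> simp [SpanAt, doc, add_comm 1]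
    | opn y =>
      simp only [doc, List.length_nil, zero_add, SpanAt, RefSym.opn.injEq]
      rw [or_comm]
      simp
    | cls y => simp [doc, SpanAt]

theorem NextCls.le {x : X} {w : List (RefSym A X)} {j : ℕ} (h : NextCls x w j) :
    j ≤ (doc w).length := by
  induction w generalizing j with
  | nil => exact h.elim
  | cons c w ih =>
    cases c with
    | letter a => cases j with
      | zero => exact h.elim
      | succ j => exact Nat.succ_le_succ (ih h)
    | opn y => exact ih h.2
    | cls y =>
      by_cases hy : y = x
      · simp only [NextCls, hy, if_true] at h
        simp [h]
      · simp only [NextCls, hy, if_false] at h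
        exact ih h

theorem SpanAt.le {x : X} {w : List (RefSym A X)} {i j : ℕ} (h : SpanAt x w i j) :
    i ≤ j ∧ j ≤ (doc w).length := by
  induction w generalizing i j with
  | nil => exact h.elim
  | cons c w ih =>
    cases c with
    | letter a =>
      cases i <;> cases j <;> first | exact h.elim | skip
      simpa [doc] using ih h
    | opn y =>
      rcases h with h | ⟨-, rfl, h⟩
      · exact ih h
      · exact ⟨Nat.zero_le _, h.le⟩
    | cls y => exact ih h

theorem NextCls.unique {x : X} {w : List (RefSym A X)} {j j' : ℕ} (h : NextCls x w j)
    (h' : NextCls x w j') : j = j' := by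
  induction w generalizing j j' with
  | nil => exact h.elim
  | cons c w ih =>
    cases c with
    | letter a =>
      cases j <;> cases j' <;> first | exact h.elim | exact h'.elim | skip
      exact congrArg _ (ih h h')
    | opn y => exact ih h.2 h'.2
    | cls y =>
      by_cases hy : y = x
      · simp only [NextCls, hy, if_true] at h h'
        rw [h, h']
      · simp only [NextCls, hy, if_false] at h h'
        exact ih h h'

theorem NextCls.le_of_spanAt {x : X} {w : List (RefSym A X)} {j i' j' : ℕ} (h : NextCls x w j)
    (h' : SpanAt x w i' j') : j ≤ i' := by
  induction w generalizing j i' j' with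
  | nil => exact h.elim
  | cons c w ih =>
    cases c with
    | letter a =>
      cases j <;> cases i' <;> cases j' <;> first | exact h.elim | exact h'.elim | skip
      exact Nat.succ_le_succ (ih h h')
    | opn y =>
      rcases h' with h' | ⟨hy, -⟩
      · exact ih h.2 h'
      · exact (h.1 hy).elim
    | cls y =>
      by_cases hy : y = x
      · simp only [NextCls, hy, if_true] at h
        simp [h]
      · simp only [NextCls, hy, if_false] at h
        exact ih h h'

/-- A span ends at the next bracket of x, so a span opened later cannot start before that end. This
holds for all words, well-bracketed or not. -/
theorem SpanAt.disjoint {x : X} {w : List (RefSym A X)} {i j i' j' : ℕ} (h : SpanAt x w i j)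
    (h' : SpanAt x w i' j') (hne : (i, j) ≠ (i', j')) : j ≤ i' ∨ j' ≤ i := by
  induction w generalizing i j i' j' with
  | nil => exact h.elim
  | cons c w ih =>
    cases c with
    | letter a =>
      cases i <;> cases j <;> cases i' <;> cases j' <;> first | exact h.elim | exact h'.elim | skip
      simpa using ih h h' (by simpa using hne)
    | opn y =>
      rcases h with h | ⟨-, rfl, h⟩ <;> rcases h' with h' | ⟨-, rfl, h'⟩
      · exact ih h h' hne
      · exact .inr (h'.le_of_spanAt h)
      · exact .inl (h.le_of_spanAt h')
      · exact (hne (by rw [h.unique h'])).elim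
    | cls y => exact ih h h' hne

/-- The brackets of `x` alternate, the first one being closing iff `b` holds, and the last one is
closing. -/
def Alternating (x : X) : Bool → List (RefSym A X) → Prop
  | b, [] => b = false
  | b, .letter _ :: w => Alternating x b w
  | b, .opn y :: w => if y = x then b = false ∧ Alternating x true w else Alternating x b w
  | b, .cls y :: w => if y = x then b = true ∧ Alternating x false w else Alternating x b w

theorem Alternating.not_nextCls {x : X} {w : List (RefSym A X)} (h : Alternating x false w)
    (j : ℕ) : ¬ NextCls x w j := by
  intro hj
  induction w generalizing j with
  | nil => exact hj
  | cons c w ih =>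
    cases c with
    | letter a => cases j with
      | zero => exact hj
      | succ j => exact ih h j hj
    | opn y => exact ih (by simpa [Alternating, hj.1] using h) j hj.2
    | cls y => by_cases hy : y = x <;> simp_all [Alternating, NextCls]

theorem Alternating.exists_nextCls {x : X} {w : List (RefSym A X)} (h : Alternating x true w) :
    ∃ j, NextCls x w j := by
  induction w with
  | nil => simp [Alternating] at h
  | cons c w ih =>
    cases c with
    | letter a => exact (ih h).imp' _ fun j hj => (hj : NextCls x (.letter a :: w) (j + 1))
    | opn y => by_cases hy : y = x <;> simp_all [Alternating, NextCls]
    | cls y => by_cases hy : y = x <;> simp_all [Alternating, NextCls]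

theorem Alternating.append {x : X} {b : Bool} {u v : List (RefSym A X)} (hu : Alternating x b u)
    (hv : Alternating x false v) : Alternating x b (u ++ v) := by
  induction u generalizing b with
  | nil => cases hu; exact hv
  | cons c u ih =>
    cases c with
    | letter a => exact ih hu
    | opn y =>
      by_cases hy : y = x
      · simp only [Alternating, if_pos hy, List.cons_append] at hu ⊢
        exact ⟨hu.1, ih hu.2⟩
      · simp only [Alternating, if_neg hy, List.cons_append] at hu ⊢
        exact ih hu
    | cls y =>
      by_cases hy : y = x
      · simp only [Alternating, if_pos hy, List.cons_append] at hu ⊢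
        exact ⟨hu.1, ih hu.2⟩
      · simp only [Alternating, if_neg hy, List.cons_append] at hu ⊢
        exact ih hu

theorem alternating_append_of_notMem {x : X} {b : Bool} {u v : List (RefSym A X)}
    (ho : RefSym.opn x ∉ u) (hc : RefSym.cls x ∉ u) (hv : Alternating x b v) :
    Alternating x b (u ++ v) := by
  induction u with
  | nil => exact hv
  | cons c u ih =>
    simp only [List.mem_cons, not_or] at ho hc
    specialize ih ho.2 hc.2
    cases c with
    | letter a => exact ih
    | opn y => simpa [Alternating, show y ≠ x from fun h => ho.1 (h ▸ rfl)] using ih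
    | cls y => simpa [Alternating, show y ≠ x from fun h => hc.1 (h ▸ rfl)] using ih

/-- Which brackets of every variable occur in a gap, as the numbers `c`, `e` and `o`. -/
abbrev Label (X : Type*) : Type _ := X → Bool × Bool × Bool

/-- The labels of the gaps of the document in a word. -/
def labels : List (RefSym A X) → List (Label X)
  | [] => [fun _ => (false, false, false)]
  | .letter _ :: w => (fun _ => (false, false, false)) :: labels w
  | .opn x :: w => (labels w).modifyHead fun z => Function.update z x
      (if (z x).1 then (false, true, (z x).2.2) else (false, (z x).2.1, true))
  | .cls x :: w => (labels w).modifyHead fun z => Function.update z x (true, (z x).2)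

theorem length_labels (w : List (RefSym A X)) : (labels w).length = (doc w).length + 1 := by
  induction w with
  | nil => rfl
  | cons c w ih => cases c <;> simp [labels, doc, ih]

/-- Labels are computed from the right, so a suffix may contain a closing bracket whose partner lies
further left. The disjunct `NextCls` accounts for this pending bracket; it is void for whole words,
by `Alternating.not_nextCls`. -/
theorem labels_spec {x : X} {b : Bool} {w : List (RefSym A X)} (h : Alternating x b w) (i : ℕ)
    (z : Label X) (hz : (labels w)[i]? = some z) :
    ((z x).1 = true ↔ (∃ j, j ≠ i ∧ SpanAt x w j i) ∨ NextCls x w i) ∧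
    ((z x).2.1 = true ↔ SpanAt x w i i) ∧
    ((z x).2.2 = true ↔ ∃ j, j ≠ i ∧ SpanAt x w i j) := by
  induction w generalizing b i z with
  | nil =>
    cases i <;> simp [labels] at hz
    subst hz
    simp [SpanAt, NextCls]
  | cons c w ih =>
    cases c with
    | letter a =>
      cases i with
      | zero =>
        simp [labels] at hz
        subst hz
        simp only [NextCls, SpanAt]
        refine ⟨by simp, by simp, by simp⟩
      | succ i =>
        obtain ⟨h1, h2, h3⟩ := ih h i z (by simpa [labels] using hz)
        refine ⟨h1.trans (or_congr ⟨?_, ?_⟩ Iff.rfl), h2, h3.trans ⟨?_, ?_⟩⟩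
        · rintro ⟨j, hj, h⟩; exact ⟨j + 1, by simpa using hj, h⟩
        · rintro ⟨_ | j, hj, h⟩
          · exact h.elim
          · exact ⟨j, by simpa using hj, h⟩
        · rintro ⟨j, hj, h⟩; exact ⟨j + 1, by simpa using hj, h⟩
        · rintro ⟨_ | j, hj, h⟩
          · exact h.elim
          · exact ⟨j, by simpa using hj, h⟩
    | opn y =>
      obtain ⟨z₀, zs, hl⟩ : ∃ z₀ zs, labels w = z₀ :: zs :=
        List.exists_cons_of_length_eq_add_one (length_labels w)
      by_cases hy : y = x
      · subst hy
        simp only [Alternating, if_true] at h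
        obtain ⟨j₀, hj₀⟩ := h.2.exists_nextCls
        have hu : ∀ j, NextCls y w j ↔ j = j₀ := fun j => ⟨fun h => h.unique hj₀, fun h => h ▸ hj₀⟩
        cases i with
        | zero =>
          obtain ⟨h1, h2, h3⟩ := ih h.2 0 z₀ (by simp [hl])
          have h0' : ∀ j, ¬ SpanAt y w (j + 1) 0 := fun j h => absurd h.le.1 (by omega)
          have h0 : ¬ ∃ j, j ≠ 0 ∧ SpanAt y w j 0 := fun ⟨j, hj, h⟩ => hj (Nat.le_zero.1 h.le.1)
          simp [labels, hl] at hz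
          subst hz
          simp only [SpanAt, NextCls, hu, h0, false_or, Function.update_self] at h1 ⊢
          -- For `j₀ = 0` the pending bracket lies in the same gap and the span is empty; otherwise
          -- a nonempty span starts here.
          by_cases hj : j₀ = 0
          · subst hj
            simp only [h1.2 rfl, if_true]
            refine ⟨by simpa using h0', by simp, ?_⟩
            rw [h3]
            refine exists_congr fun j => and_congr_right fun hj => ?_
            simp [hj]
          · have : ¬ (z₀ y).1 = true := fun h => hj (h1.1 h).symm
            simp only [this, Bool.false_eq_true, if_false, h2]
            refine ⟨by simpa using h0', ?_, ?_⟩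
            · simp [Ne.symm hj]
            · simp only [true_iff]
              exact ⟨j₀, hj, .inr ⟨trivial, trivial, rfl⟩⟩
        | succ i =>
          obtain ⟨h1, h2, h3⟩ := ih h.2 (i + 1) z (by simpa [labels, hl] using hz)
          simp only [SpanAt, NextCls, ne_eq, not_true_eq_false, false_and, or_false, h1, h2, h3]
          refine ⟨⟨?_, ?_⟩, by simp, by simp⟩
          · rintro (⟨j, hj, h⟩ | h)
            · exact ⟨j, hj, .inl h⟩
            · exact ⟨0, by simp, .inr ⟨trivial, rfl, h⟩⟩
          · rintro ⟨j, hj, h | ⟨-, -, h⟩⟩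
            · exact .inl ⟨j, hj, h⟩
            · exact .inr h
      · simp only [Alternating, if_neg hy] at h
        simp only [SpanAt, NextCls, hy, false_and, or_false, ne_eq, not_false_eq_true, true_and]
        cases i with
        | zero =>
          simp [labels, hl] at hz
          subst hz
          rw [Function.update_of_ne (Ne.symm hy)]
          exact ih h 0 z₀ (by simp [hl])
        | succ i => exact ih h (i + 1) z (by simpa [labels, hl] using hz)
    | cls y =>
      obtain ⟨z₀, zs, hl⟩ : ∃ z₀ zs, labels w = z₀ :: zs :=
        List.exists_cons_of_length_eq_add_one (length_labels w)
      by_cases hy : y = x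
      · subst hy
        simp only [Alternating, if_true] at h
        have hn := h.2.not_nextCls
        simp only [SpanAt, NextCls, if_true]
        cases i with
        | zero =>
          obtain ⟨h1, h2, h3⟩ := ih h.2 0 z₀ (by simp [hl])
          simp [labels, hl] at hz
          subst hz
          rw [Function.update_self]
          exact ⟨by simp, h2, h3⟩
        | succ i =>
          obtain ⟨h1, h2, h3⟩ := ih h.2 (i + 1) z (by simpa [labels, hl] using hz)
          exact ⟨h1.trans (or_congr_right (by simpa using hn _)), h2, h3⟩
      · simp only [Alternating, if_neg hy] at h
        simp only [SpanAt, NextCls, hy, if_false]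
        cases i with
        | zero =>
          simp [labels, hl] at hz
          subst hz
          rw [Function.update_of_ne (Ne.symm hy)]
          exact ih h 0 z₀ (by simp [hl])
        | succ i => exact ih h (i + 1) z (by simpa [labels, hl] using hz)

/-! ### Brackets in the words of an expression -/

theorem Expr.notMem_of_not_mentions {x : X} {R : Expr A X} (h : ¬ R.Mentions x)
    {w : List (RefSym A X)} (hw : w ∈ R.lang) : RefSym.opn x ∉ w ∧ RefSym.cls x ∉ w := by
  induction R generalizing w with
  | eps => cases hw; simp
  | sym a => cases hw; simp
  | cat R R' ih ih' =>
    simp only [Mentions, not_or] at h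
    obtain ⟨u, hu, v, hv, rfl⟩ := hw
    simpa [not_or] using ⟨⟨(ih h.1 hu).1, (ih' h.2 hv).1⟩, (ih h.1 hu).2, (ih' h.2 hv).2⟩
  | alt R R' ih ih' =>
    simp only [Mentions, not_or] at h
    rcases hw with hw | hw
    · exact ih h.1 hw
    · exact ih' h.2 hw
  | star R ih =>
    obtain ⟨l, rfl, hl⟩ := hw
    simp only [List.mem_flatten, not_exists, not_and]
    exact ⟨fun w hw => (ih h (hl w hw)).1, fun w hw => (ih h (hl w hw)).2⟩
  | bind y R ih =>
    simp only [Mentions, not_or] at h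
    obtain ⟨_, ⟨_, rfl, v, hv, rfl⟩, _, rfl, rfl⟩ := hw
    simpa [h.1] using ih h.2 hv

/-- The side condition on `x{R}` keeps brackets of x out of the words of R, so they cannot nest; all
other constructs concatenate alternating words. -/
theorem Expr.WellFormed.alternating {R : Expr A X} (h : R.WellFormed) {w : List (RefSym A X)}
    (hw : w ∈ R.lang) (x : X) : Alternating x false w := by
  induction R generalizing w with
  | eps => cases hw; rfl
  | sym a => cases hw; rfl
  | cat R R' ih ih' =>
    obtain ⟨u, hu, v, hv, rfl⟩ := hw
    exact (ih h.1 hu).append (ih' h.2 hv)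
  | alt R R' ih ih' =>
    rcases hw with hw | hw
    · exact ih h.1 hw
    · exact ih' h.2 hw
  | star R ih =>
    obtain ⟨l, rfl, hl⟩ := hw
    induction l with
    | nil => rfl
    | cons w l ihl =>
      rw [List.flatten_cons]
      exact (ih h (hl w (by simp))).append (ihl fun y hy => hl y (by simp [hy]))
  | bind y R ih =>
    obtain ⟨_, ⟨_, rfl, v, hv, rfl⟩, _, rfl, rfl⟩ := hw
    by_cases hy : y = x
    · subst hy
      obtain ⟨h1, h2⟩ := Expr.notMem_of_not_mentions h.1 hv
      simp only [List.cons_append, Alternating, if_true, true_and]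
      exact alternating_append_of_notMem h1 h2 (by simp [Alternating])
    · simp only [List.cons_append, Alternating, if_neg hy]
      exact (ih h.2 hv).append (by simp [Alternating, hy])

end Spans

/-! ### Tuples as lists of labels -/

section Tuples

variable {A X : Type*}

/-- The bag of the words of a given length over a finite alphabet. -/
noncomputable def words (Z : Type*) [Finite Z] : ℕ → Multiset (List Z)
  | 0 => {[]}
  | n + 1 => (univBag Z).bind fun z => (words Z n).map fun l => z :: l

theorem mem_words {Z : Type*} [Finite Z] {n : ℕ} {l : List Z} : l ∈ words Z n ↔ l.length = n := by
  induction n generalizing l with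
  | zero => simp [words]
  | succ n ih =>
    simp only [words, Multiset.mem_bind, Multiset.mem_map, ih, mem_univBag, true_and]
    cases l <;> simp

theorem nodup_words (Z : Type*) [Finite Z] (n : ℕ) : (words Z n).Nodup := by
  induction n with
  | zero => simp [words]
  | succ n ih =>
    rw [words, Multiset.nodup_bind]
    refine ⟨fun z _ => ih.map (List.cons_injective), (nodup_univBag Z).pairwise ?_⟩
    intro z _ z' _ hz
    rw [Function.onFun, Multiset.disjoint_left]
    simp only [Multiset.mem_map]
    rintro _ ⟨l, -, rfl⟩ ⟨l', -, h⟩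
    exact hz (List.cons.inj h).1.symm

open Classical in
/-- The label of a gap in a tuple. -/
noncomputable def tupleLabel {n : ℕ} (t : MultispanTuple n X) (i : Fin (n + 1)) : Label X := fun x =>
  (decide (∃ s ∈ t.1 x, s.finish = i ∧ s.start ≠ i),
    decide (∃ s ∈ t.1 x, s.start = i ∧ s.finish = i),
    decide (∃ s ∈ t.1 x, s.start = i ∧ s.finish ≠ i))

/-- The labels of all gaps in a tuple. -/
noncomputable def tupleLabels {n : ℕ} (t : MultispanTuple n X) : List (Label X) :=
  List.ofFn (tupleLabel t)

/-- Empty spans are recorded directly. For a nonempty span s of t, the label at its start yields a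
span s' of t' with the same start. If the ends differ, the label at the earlier one gives the tuple
with the longer span another span ending strictly inside it, against disjointness. -/
theorem tupleLabels_injective {n : ℕ} :
    Function.Injective (tupleLabels : MultispanTuple n X → List (Label X)) := by
  have key : ∀ (t t' : MultispanTuple n X), tupleLabels t = tupleLabels t' →
      ∀ x, t.1 x ⊆ t'.1 x := by
    intro t t' h x s hs
    have hl : ∀ i, tupleLabel t i x = tupleLabel t' i x := fun i =>
      congrFun (congrFun (List.ofFn_injective h) i) x
    simp only [tupleLabel, Prod.mk.injEq, decide_eq_decide] at hl
    by_cases he : s.finish = s.start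
    · obtain ⟨s', hs', h1, h2⟩ := (hl s.start).2.1.1 ⟨s, hs, rfl, he⟩
      have : s' = s := Subtype.ext (Prod.ext h1 (h2.trans he.symm))
      exact this ▸ hs'
    · obtain ⟨s', hs', h1, h2⟩ := (hl s.start).2.2.1 ⟨s, hs, rfl, he⟩
      have hlt : s.start < s.finish := lt_of_le_of_ne s.2 (Ne.symm he)
      have hlt' : s'.start < s'.finish := lt_of_le_of_ne s'.2 (by rw [h1]; exact h2.symm)
      rcases lt_trichotomy s'.finish s.finish with hf | hf | hf
      · obtain ⟨s₂, hs₂, h3, h4⟩ := (hl s'.finish).1.2 ⟨s', hs', rfl, hlt'.ne⟩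
        have hlt₂ : s₂.start < s₂.finish := lt_of_le_of_ne s₂.2 (by rw [h3]; exact h4)
        rcases t.2 x s hs s₂ hs₂ (by rintro rfl; exact hf.ne h3.symm) with h5 | h5
        · exact absurd (h5.trans hlt₂.le) (by rw [h3]; exact hf.not_ge)
        · exact absurd h5 (by rw [h3, ← h1]; exact hlt'.not_ge)
      · have : s' = s := Subtype.ext (Prod.ext h1 hf)
        exact this ▸ hs'
      · obtain ⟨s₂, hs₂, h3, h4⟩ := (hl s.finish).1.1 ⟨s, hs, rfl, hlt.ne⟩
        have hlt₂ : s₂.start < s₂.finish := lt_of_le_of_ne s₂.2 (by rw [h3]; exact h4)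
        rcases t'.2 x s' hs' s₂ hs₂ (by rintro rfl; exact hf.ne h3.symm) with h5 | h5
        · exact absurd (h5.trans hlt₂.le) (by rw [h3]; exact hf.not_ge)
        · exact absurd h5 (by rw [h3, h1]; exact hlt.not_ge)
  intro t t' h
  refine Subtype.ext (funext fun x => ?_)
  exact (key t t' h x).antisymm (key t' t h.symm x)

variable [DecidableEq X]

/-- The tuple of the spans of a word. -/
noncomputable def tupleOf (D : List A) (w : List (RefSym A X)) : MultispanTuple D.length X := by
  classical
  exact ⟨fun x => Finset.univ.filter fun s => HasSpan w x s.start s.finish, fun x s hs s' hs' hne => by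
    simp only [Finset.mem_filter, hasSpan_iff_spanAt] at hs hs'
    refine (hs.2.disjoint hs'.2 fun h => hne (Subtype.ext (Prod.ext ?_ ?_))).imp id id
    · exact Fin.ext (congrArg Prod.fst h)
    · exact Fin.ext (congrArg Prod.snd h)⟩

theorem mem_tupleOf (D : List A) (w : List (RefSym A X)) (x : X) (s : Span D.length) :
    s ∈ (tupleOf D w).1 x ↔ HasSpan w x s.start s.finish := by
  simp [tupleOf]

theorem tupleLabels_eq_labels {D : List A} {w : List (RefSym A X)} (hw : ∀ x, Alternating x false w)
    (hD : doc w = D) {t : MultispanTuple D.length X}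
    (ht : ∀ x s, s ∈ t.1 x ↔ HasSpan w x s.start s.finish) : tupleLabels t = labels w := by
  refine List.ext_getElem (by simp [tupleLabels, length_labels, hD]) fun i hi hi' => ?_
  have hi₀ : i < D.length + 1 := by simpa [tupleLabels] using hi
  simp only [tupleLabels, List.getElem_ofFn]
  funext x
  obtain ⟨h1, h2, h3⟩ := labels_spec (hw x) i _ (List.getElem?_eq_getElem hi')
  have hle : ∀ {i j}, SpanAt x w i j → j < D.length + 1 := fun h => by
    have := h.le.2
    rw [hD] at this
    omega
  simp only [hasSpan_iff_spanAt] at ht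
  simp only [tupleLabel]
  refine Prod.ext ?_ (Prod.ext ?_ ?_)
  · rw [Bool.eq_iff_iff, decide_eq_true_iff, h1]
    constructor
    · rintro ⟨s, hs, hf, hne⟩
      refine .inl ⟨s.start, fun h => hne (Fin.ext h), ?_⟩
      rw [ht, hf] at hs
      exact hs
    · rintro (⟨j, hj, h⟩ | h)
      · have hj' : j < D.length + 1 := h.le.1.trans_lt hi₀
        exact ⟨⟨(⟨j, hj'⟩, ⟨i, hi₀⟩), h.le.1⟩, (ht _ _).2 h, rfl, fun h' => hj (congrArg Fin.val h')⟩
      · exact ((hw x).not_nextCls _ h).elim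
  · rw [Bool.eq_iff_iff, decide_eq_true_iff, h2]
    constructor
    · rintro ⟨s, hs, hf, hf'⟩
      rw [ht, hf, hf'] at hs
      exact hs
    · intro h
      exact ⟨⟨(⟨i, hi₀⟩, ⟨i, hi₀⟩), le_rfl⟩, (ht _ _).2 h, rfl, rfl⟩
  · rw [Bool.eq_iff_iff, decide_eq_true_iff, h3]
    constructor
    · rintro ⟨s, hs, hf, hne⟩
      refine ⟨s.finish, fun h => hne (Fin.ext h), ?_⟩
      rw [ht, hf] at hs
      exact hs
    · rintro ⟨j, hj, h⟩
      exact ⟨⟨(⟨i, hi₀⟩, ⟨j, hle h⟩), h.le.1⟩, (ht _ _).2 h, rfl, fun h' => hj (congrArg Fin.val h')⟩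

end Tuples

/-! ### Encodings and evaluation in terms of label lists -/

section Encoding

variable {A X : Type*} [Fintype X] [LinearOrder X]

/-- The word of brackets described by a label. -/
def labelWord (z : Label X) : List (RefSym A X) :=
  (Finset.univ.sort (fun x y : X => x ≤ y)).flatMap fun x =>
    (if (z x).1 then [RefSym.cls x] else []) ++
      (if (z x).2.1 then [RefSym.opn x, RefSym.cls x] else []) ++
      (if (z x).2.2 then [RefSym.opn x] else [])

/-- The encoding of a document and a list of labels. -/
def encodeLabels : List (Label X) → List A → List (RefSym A X)
  | [], _ => []
  | z :: _, [] => labelWord z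
  | z :: zs, a :: D => labelWord z ++ RefSym.letter a :: encodeLabels zs D

theorem gap_eq_labelWord {n : ℕ} (t : MultispanTuple n X) (i : Fin (n + 1)) :
    gap t i = (labelWord (tupleLabel t i) : List (RefSym A X)) := by
  unfold gap labelWord gapVar tupleLabel
  simp only [decide_eq_true_eq]

theorem encode_eq_encodeLabels (D : List A) (t : MultispanTuple D.length X) :
    encode D t = encodeLabels (tupleLabels t) D := by
  have key : ∀ (D : List A) (h : Fin (D.length + 1) → Label X),
      (List.finRange D.length).flatMap
          (fun i => labelWord (h i.castSucc) ++ [RefSym.letter (D.get i)]) ++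
        labelWord (h (Fin.last D.length)) = encodeLabels (List.ofFn h) D := by
    intro D
    induction D with
    | nil => intro h; simp [encodeLabels]
    | cons a D ih =>
      intro h
      rw [List.ofFn_succ, encodeLabels]
      refine Eq.trans ?_ (congrArg (fun l => labelWord (h 0) ++ RefSym.letter a :: l)
        (ih fun i => h i.succ))
      simp only [List.length_cons, List.finRange_succ, List.flatMap_cons, List.flatMap_map]
      simp
  unfold encode
  simp only [gap_eq_labelWord]
  exact key D _

-- A transducer can guess a label list gap by gap. The condition on `w` is mere existence, so a
-- tuple described by several words is counted once.
open Classical in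
theorem eval_eq_filterMap_words {B : Type*} (P : Program A X B) (R : Expr A X) (hR : R.WellFormed)
    (hE : P.E = languageMultispanner R.lang) (D : List A) :
    P.eval D = (words (Label X) (D.length + 1)).filterMap fun zs =>
      if ∃ w ∈ R.lang, doc w = D ∧ labels w = zs then P.T (encodeLabels zs D) else none := by
  have h : (Set.toFinite (P.E D)).toFinset.val.map tupleLabels =
      (words (Label X) (D.length + 1)).filter fun zs =>
        ∃ w ∈ R.lang, doc w = D ∧ labels w = zs := by
    refine (Multiset.Nodup.ext ((Finset.nodup _).map tupleLabels_injective)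
      ((nodup_words _ _).filter _)).2 fun zs => ?_
    simp only [Multiset.mem_map, Finset.mem_val, Set.Finite.mem_toFinset, Multiset.mem_filter,
      mem_words, hE]
    constructor
    · rintro ⟨t, ⟨w, hw, hD, ht⟩, rfl⟩
      exact ⟨by simp [tupleLabels], w, hw, hD,
        (tupleLabels_eq_labels (fun x => hR.alternating hw x) hD ht).symm⟩
    · rintro ⟨-, w, hw, hD, rfl⟩
      exact ⟨tupleOf D w, ⟨w, hw, hD, fun x s => mem_tupleOf D w x s⟩,
        tupleLabels_eq_labels (fun x => hR.alternating hw x) hD fun x s => mem_tupleOf D w x s⟩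
  unfold Program.eval
  simp only [encode_eq_encodeLabels]
  have h' := Multiset.filterMap_map tupleLabels (fun zs => P.T (encodeLabels zs D))
    (Set.toFinite (P.E D)).toFinset.val
  rw [h, Multiset.filterMap_filter] at h'
  refine h'.symm.trans ?_
  congr

end Encoding

/-! ### Regularity of the languages of expressions -/

section Regular

variable {A : Type*} {L M : Language A}

/-- The union of a set of languages. -/
def unionOf (S : Set (Language A)) : Language A := {y | ∃ Q ∈ S, y ∈ Q}

theorem leftQuotient_mul (w : List A) :
    (L * M).leftQuotient w = L.leftQuotient w * M +
      unionOf {Q | ∃ u v, u ++ v = w ∧ u ∈ L ∧ Q = M.leftQuotient v} := by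
  ext y
  constructor
  · rintro ⟨u, hu, v, hv, h⟩
    rcases List.append_eq_append_iff.1 h with ⟨c, rfl, rfl⟩ | ⟨c, rfl, rfl⟩
    · exact .inr ⟨_, ⟨u, c, rfl, hu, rfl⟩, hv⟩
    · exact .inl ⟨c, hu, v, hv, rfl⟩
  · rintro (⟨u, hu, v, hv, rfl⟩ | ⟨_, ⟨u, v, rfl, hu, rfl⟩, hy⟩)
    · exact ⟨w ++ u, hu, v, hv, by simp⟩
    · exact ⟨u, hu, v ++ y, hy, by simp⟩

/-- Myhill–Nerode: a quotient of LM is determined by a quotient of L and a set of quotients of M,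
for both of which there are finitely many possibilities. -/
theorem isRegular_mul (hL : L.IsRegular) (hM : M.IsRegular) : (L * M).IsRegular := by
  have hL := hL.finite_range_leftQuotient
  have hM := hM.finite_range_leftQuotient
  refine .of_finite_range_leftQuotient (((hL.prod hM.powerset).image
    fun p : Language A × Set (Language A) => p.1 * M + unionOf p.2).subset ?_)
  rintro _ ⟨w, rfl⟩
  refine ⟨(L.leftQuotient w, _), ⟨⟨w, rfl⟩, ?_⟩, (leftQuotient_mul w).symm⟩
  rintro _ ⟨u, v, -, -, rfl⟩
  exact ⟨v, rfl⟩

open scoped Computability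

theorem mem_leftQuotient_kstar (w y : List A) :
    y ∈ L∗.leftQuotient w ↔ (w = [] ∧ y ∈ L∗) ∨
      ∃ u v, u ++ v = w ∧ u ∈ L∗ ∧ y ∈ L.leftQuotient v * L∗ := by
  constructor
  · rintro ⟨l, h, hl⟩
    induction l generalizing w with
    | nil =>
      simp only [List.flatten_nil, List.append_eq_nil_iff] at h
      exact .inl ⟨h.1, h.2 ▸ Language.nil_mem_kstar L⟩
    | cons x l ih =>
      have hx := hl x (by simp)
      have hl' : ∀ y ∈ l, y ∈ L := fun y hy => hl y (by simp [hy])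
      rw [List.flatten_cons] at h
      rcases List.append_eq_append_iff.1 h with ⟨c, rfl, rfl⟩ | ⟨c, rfl, h'⟩
      · exact .inr ⟨[], w, rfl, Language.nil_mem_kstar L, c, hx, _, ⟨l, rfl, hl'⟩, rfl⟩
      · rcases ih c h'.symm hl' with ⟨rfl, hy⟩ | ⟨u, v, rfl, ⟨l', rfl, hl''⟩, hy⟩
        · exact .inr ⟨[], x, by simp, Language.nil_mem_kstar L, [], by
            change x ++ [] ∈ L; rwa [List.append_nil], y, hy, rfl⟩
        · refine .inr ⟨x ++ l'.flatten, v, by simp, ⟨x :: l', rfl, ?_⟩, hy⟩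
          simpa using ⟨hx, hl''⟩
  · rintro (⟨rfl, hy⟩ | ⟨_, v, rfl, ⟨l, rfl, hl⟩, u, hu, _, ⟨l', rfl, hl'⟩, rfl⟩)
    · exact hy
    · refine ⟨l ++ (v ++ u) :: l', by simp, ?_⟩
      intro z hz
      simp only [List.mem_append, List.mem_cons] at hz
      rcases hz with hz | rfl | hz
      · exact hl z hz
      · exact hu
      · exact hl' z hz

/-- Myhill–Nerode again: the quotient by w depends on whether w is empty and on the set of quotients
of L by the possible unfinished last factors of w. -/
theorem isRegular_kstar (hL : L.IsRegular) : L∗.IsRegular := by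
  have hL := hL.finite_range_leftQuotient
  refine .of_finite_range_leftQuotient (((Set.finite_univ.prod hL.powerset).image
    fun p : Prop × Set (Language A) =>
      ({y | (p.1 ∧ y ∈ L∗) ∨ ∃ Q ∈ p.2, y ∈ Q * L∗} : Language A)).subset ?_)
  rintro _ ⟨w, rfl⟩
  refine ⟨(w = [], {Q | ∃ u v, u ++ v = w ∧ u ∈ L∗ ∧ Q = L.leftQuotient v}), ⟨trivial, ?_⟩, ?_⟩
  · rintro _ ⟨u, v, -, -, rfl⟩
    exact ⟨v, rfl⟩
  · ext y
    refine Iff.trans ?_ (mem_leftQuotient_kstar w y).symm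
    refine or_congr Iff.rfl ⟨?_, ?_⟩
    · rintro ⟨_, ⟨u, v, h, hu, rfl⟩, hy⟩
      exact ⟨u, v, h, hu, hy⟩
    · rintro ⟨u, v, h, hu, hy⟩
      exact ⟨_, ⟨u, v, h, hu, rfl⟩, hy⟩

theorem isRegular_one : (1 : Language A).IsRegular := by
  refine .of_finite_range_leftQuotient ((Set.toFinite {1, 0}).subset ?_)
  rintro _ ⟨w, rfl⟩
  cases w with
  | nil => exact .inl rfl
  | cons a w =>
    refine .inr ?_
    ext y
    simp [Language.mem_leftQuotient, Language.mem_one, Language.notMem_zero]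

theorem isRegular_singleton (a : A) : ({[a]} : Language A).IsRegular := by
  refine .of_finite_range_leftQuotient ((Set.toFinite {{[a]}, 1, 0}).subset ?_)
  rintro _ ⟨w, rfl⟩
  cases w with
  | nil => exact .inl rfl
  | cons b w =>
    refine .inr ?_
    by_cases h : b = a ∧ w = []
    · refine .inl ?_
      ext y
      change b :: w ++ y = [a] ↔ y = []
      simp [h]
    · refine .inr ?_
      ext y
      change b :: w ++ y = [a] ↔ False
      simp only [List.cons_append, List.cons.injEq, List.append_eq_nil_iff, iff_false]
      exact fun h' => h ⟨h'.1, h'.2.1⟩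

theorem Expr.isRegular_lang {X : Type*} (R : Expr A X) : R.lang.IsRegular := by
  induction R with
  | eps => exact isRegular_one
  | sym a => exact isRegular_singleton _
  | cat R R' ih ih' => exact isRegular_mul ih ih'
  | alt R R' ih ih' => exact ih.add ih'
  | star R ih => exact isRegular_kstar ih
  | bind x R ih => exact isRegular_mul (isRegular_mul (isRegular_singleton _) ih) (isRegular_singleton _)

end Regular

/-! ### Runs of deterministic streaming string transducers -/

namespace DSST

attribute [instance] DSST.finQ DSST.finR DSST.decR

variable {A B : Type*} (𝒯 : DSST A B)

/-- The assignment and the state after reading a word. -/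
def run (𝒯 : DSST A B) : List A → 𝒯.Q → Option (Assignment 𝒯.R B × 𝒯.Q)
  | [], q => some (idAssignment, q)
  | a :: w, q => (𝒯.Δ q a).bind fun p => (run 𝒯 w p.2).map fun r => (comp p.1 r.1, r.2)

theorem run_copyless (w : List A) (q : 𝒯.Q) : ∀ r ∈ 𝒯.run w q, r.1.Copyless := by
  induction w generalizing q with
  | nil =>
    simp only [run, Option.mem_def, Option.some.injEq]
    rintro _ rfl
    exact copyless_id
  | cons a w ih =>
    simp only [run, Option.mem_def, Option.bind_eq_some_iff, Option.map_eq_some_iff]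
    rintro _ ⟨p, hp, r, hr, rfl⟩
    exact (𝒯.copyless q a p.1 p.2 hp).comp (ih p.2 r hr)

theorem evalFrom_append (u v : List A) (q : 𝒯.Q) (ν : Valuation 𝒯.R B) :
    𝒯.evalFrom (u ++ v) q ν = (𝒯.run u q).bind fun r => 𝒯.evalFrom v r.2 (ν.comp r.1) := by
  induction u generalizing q ν with
  | nil => simp [run, valuation_comp_id]
  | cons a u ih =>
    simp only [List.cons_append, evalFrom, run, Option.bind_assoc]
    congr 1
    funext p
    rw [ih]
    cases 𝒯.run u p.2 <;> simp [valuation_comp_comp]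

theorem evalFrom_nil (q : 𝒯.Q) (ν : Valuation 𝒯.R B) :
    𝒯.evalFrom [] q ν = (𝒯.F q).bind (subst (value ν)) := by
  simp only [evalFrom]
  congr 1
  funext w
  exact extend_eq_subst ν w

end DSST

/-! ### From linear programs to nondeterministic streaming string transducers -/

section OfProgram

theorem labels_append_letter {A X : Type*} [DecidableEq X] (g : List (RefSym A X))
    (hg : doc g = []) : ∃ z, labels g = [z] ∧
      ∀ a w, labels (g ++ RefSym.letter a :: w) = z :: labels w := by
  induction g with
  | nil => exact ⟨_, rfl, fun a w => rfl⟩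
  | cons c g ih =>
    cases c with
    | letter a => simp [doc] at hg
    | opn x =>
      obtain ⟨z, h1, h2⟩ := ih hg
      exact ⟨_, by simp only [labels, h1]; rfl, fun a w => by
        simp only [List.cons_append, labels, h2]; rfl⟩
    | cls x =>
      obtain ⟨z, h1, h2⟩ := ih hg
      exact ⟨_, by simp only [labels, h1]; rfl, fun a w => by
        simp only [List.cons_append, labels, h2]; rfl⟩

theorem doc_append {A X : Type*} (u v : List (RefSym A X)) : doc (u ++ v) = doc u ++ doc v := by
  induction u with
  | nil => rfl
  | cons c u ih => cases c <;> simp [doc, ih]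

theorem exists_of_doc_eq_cons {A X : Type*} {w : List (RefSym A X)} {a : A} {D : List A}
    (h : doc w = a :: D) : ∃ g w', w = g ++ RefSym.letter a :: w' ∧ doc g = [] ∧ doc w' = D := by
  induction w with
  | nil => simp [doc] at h
  | cons c w ih =>
    cases c with
    | letter b =>
      simp only [doc, List.cons.injEq] at h
      obtain ⟨rfl, h⟩ := h
      exact ⟨[], w, rfl, rfl, h⟩
    | opn x =>
      obtain ⟨g, w', rfl, h1, h2⟩ := ih h
      exact ⟨.opn x :: g, w', rfl, h1, h2⟩
    | cls x =>
      obtain ⟨g, w', rfl, h1, h2⟩ := ih h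
      exact ⟨.cls x :: g, w', rfl, h1, h2⟩

variable {A X B : Type*} [Fintype X] [LinearOrder X] {σ : Type} (M : DFA (RefSym A X) σ)

/-- The states of an automaton after words of brackets with a given label. -/
def statesAfter (S : Set σ) (z : Label X) : Set σ :=
  {s' | ∃ s ∈ S, ∃ g, doc g = [] ∧ labels g = [z] ∧ M.evalFrom s g = s'}

/-- From some state in `S`, the automaton accepts a word with given document and labels. -/
def AcceptsLabels (S : Set σ) (D : List A) (zs : List (Label X)) : Prop :=
  ∃ s ∈ S, ∃ w, M.evalFrom s w ∈ M.accept ∧ doc w = D ∧ labels w = zs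

theorem acceptsLabels_nil (S : Set σ) (z : Label X) :
    AcceptsLabels M S [] [z] ↔ ∃ s ∈ statesAfter M S z, s ∈ M.accept := by
  constructor
  · rintro ⟨s, hs, w, h, hd, hl⟩
    exact ⟨_, ⟨s, hs, w, hd, hl, rfl⟩, h⟩
  · rintro ⟨_, ⟨s, hs, w, hd, hl, rfl⟩, h⟩
    exact ⟨s, hs, w, h, hd, hl⟩

theorem acceptsLabels_cons (S : Set σ) (a : A) (D : List A) (z : Label X) (zs : List (Label X)) :
    AcceptsLabels M S (a :: D) (z :: zs) ↔
      AcceptsLabels M ((fun s => M.step s (.letter a)) '' statesAfter M S z) D zs := by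
  constructor
  · rintro ⟨s, hs, w, h, hd, hl⟩
    obtain ⟨g, w, rfl, hg, rfl⟩ := exists_of_doc_eq_cons hd
    obtain ⟨z', h1, h2⟩ := labels_append_letter g hg
    rw [h2] at hl
    simp only [List.cons.injEq] at hl
    obtain ⟨rfl, rfl⟩ := hl
    refine ⟨_, ⟨_, ⟨s, hs, g, hg, h1, rfl⟩, rfl⟩, w, ?_, rfl, rfl⟩
    simpa [DFA.evalFrom_of_append] using h
  · rintro ⟨_, ⟨_, ⟨s, hs, g, hg, h1, rfl⟩, rfl⟩, w, h, rfl, rfl⟩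
    obtain ⟨z', h1', h2⟩ := labels_append_letter g hg
    rw [h1] at h1'
    simp only [List.cons.injEq, and_true] at h1'
    subst h1'
    refine ⟨s, hs, g ++ .letter a :: w, ?_, by simp [doc_append, hg, doc], h2 a w⟩
    simpa [DFA.evalFrom_of_append] using h

open Classical in
/-- The transducer that guesses the labels of all gaps. -/
@[reducible] noncomputable def NSST.ofProgram [Finite σ] (𝒯 : DSST (RefSym A X) B) (M : DFA (RefSym A X) σ) :
    NSST A B where
  Q := 𝒯.Q × Set σ
  R := 𝒯.R
  δ s a := (univBag (Label X)).filterMap fun z =>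
    (𝒯.run (labelWord z ++ [.letter a]) s.1).map fun r =>
      (r.1, r.2, (fun s => M.step s (.letter a)) '' statesAfter M s.2 z)
  copyless s a := by
    simp only [Multiset.mem_filterMap, Option.map_eq_some_iff]
    rintro _ ⟨z, -, r, hr, rfl⟩
    exact 𝒯.run_copyless _ _ r hr
  q₀ := (𝒯.q₀, {M.start})
  F s := (univBag (Label X)).filterMap fun z =>
    if ∃ s' ∈ statesAfter M s.2 z, s' ∈ M.accept then
      (𝒯.run (labelWord z) s.1).bind fun r => (𝒯.F r.2).bind (subst (lift r.1))
    else none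
  final_once s := by
    simp only [Multiset.mem_filterMap]
    rintro v ⟨z, -, h⟩
    split_ifs at h
    simp only [Option.bind_eq_some_iff] at h
    obtain ⟨r, hr, w, hw, hv⟩ := h
    exact NSST.countP_subst_lift_le (𝒯.run_copyless _ _ r hr) (𝒯.final_once _ w hw) hv

-- Each label list gives at most one run, since the DSST is deterministic and the automaton is
-- followed through sets of states. The contents ν are arbitrary for the sake of the induction.
open Classical in
theorem NSST.sym_ofProgram [Finite σ] (𝒯 : DSST (RefSym A X) B) (D : List A) (q : 𝒯.Q) (S : Set σ)
    (ν : Valuation 𝒯.R B) :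
    ((NSST.ofProgram 𝒯 M).sym D (q, S)).filterMap (subst (value ν)) =
      (words (Label X) (D.length + 1)).filterMap fun zs =>
        if AcceptsLabels M S D zs then 𝒯.evalFrom (encodeLabels zs D) q ν else none := by
  induction D generalizing q S ν with
  | nil =>
    simp only [sym, List.length_nil, words, Multiset.map_singleton,
      Multiset.bind_singleton, Multiset.filterMap_map]
    rw [Multiset.filterMap_filterMap]
    congr 1
    funext z
    simp only [Function.comp_apply, acceptsLabels_nil, encodeLabels]
    split_ifs
    · rw [← List.append_nil (labelWord z), DSST.evalFrom_append, List.append_nil, Option.bind_assoc]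
      congr 1
      funext r
      rw [DSST.evalFrom_nil, Option.bind_assoc]
      congr 1
      funext w
      exact bind_subst_value _ _ _
    · rfl
  | cons a D ih =>
    rw [List.length_cons, words]
    simp only [sym, Multiset.filterMap_bind, Multiset.filterMap_map]
    rw [Multiset.bind_filterMap]
    refine Multiset.bind_congr fun z _ => ?_
    simp only [Function.comp_def, acceptsLabels_cons, encodeLabels]
    have h : ∀ zs, 𝒯.evalFrom (labelWord z ++ RefSym.letter a :: encodeLabels zs D) q ν =
        (𝒯.run (labelWord z ++ [.letter a]) q).bind fun r =>
          𝒯.evalFrom (encodeLabels zs D) r.2 (ν.comp r.1) := by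
      intro zs
      rw [← DSST.evalFrom_append, List.append_assoc, List.singleton_append]
    simp only [h]
    cases 𝒯.run (labelWord z ++ [.letter a]) q with
    | none =>
      refine Eq.symm (Multiset.eq_zero_of_forall_notMem fun v hv => ?_)
      simp [Multiset.mem_filterMap] at hv
    | some r =>
      simp only [Option.map_some, Option.getD_some, Option.bind_some]
      rw [← ih, Multiset.filterMap_filterMap]
      congr 1
      funext w
      exact bind_subst_value _ _ _

theorem Program.IsLinear.exists_nsst {P : Program A X B} (h : P.IsLinear) :
    ∃ N : NSST A B, ∀ D, N.eval D = P.eval D := by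
  classical
  obtain ⟨⟨R, hR, hE⟩, 𝒯, hT⟩ := h
  obtain ⟨σ, _, M, hM⟩ := R.isRegular_lang
  refine ⟨NSST.ofProgram 𝒯 M, fun D => ?_⟩
  rw [eval_eq_filterMap_words P R hR hE, hT]
  refine (NSST.sym_ofProgram M 𝒯 D 𝒯.q₀ {M.start} emptyValuation).trans ?_
  congr 1
  funext zs
  have : AcceptsLabels M {M.start} D zs ↔ ∃ w ∈ R.lang, doc w = D ∧ labels w = zs := by
    simp only [AcceptsLabels, Set.mem_singleton_iff, exists_eq_left, ← hM]
    rfl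
  simp only [this]
  rfl

end OfProgram

/-! ### Linear growth -/

section Growth

variable {A B : Type*}

/-- By copylessness a transition adds to the total length of the registers at most the number of
letters it writes, which is bounded over all states and letters. -/
theorem DSST.exists_length_le [Finite A] (𝒯 : DSST A B) :
    ∃ K : ℕ, ∀ w v, 𝒯.eval w = some v → v.length ≤ K * (w.length + 1) := by
  obtain ⟨K₁, hK₁⟩ := (Set.finite_range fun p : 𝒯.Q × A =>
    ((𝒯.Δ p.1 p.2).map fun r => totalWt 0 (fun _ => 1) r.1).getD 0).bddAbove
  obtain ⟨K₂, hK₂⟩ := (Set.finite_range fun q : 𝒯.Q =>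
    wt (Sum.elim (0 : 𝒯.R → ℕ) fun _ => 1) ((𝒯.F q).getD [])).bddAbove
  have h₁ : ∀ q a p, 𝒯.Δ q a = some p → totalWt 0 (fun _ => 1) p.1 ≤ K₁ + K₂ := fun q a p h =>
    le_add_right (hK₁ ⟨(q, a), by simp [h]⟩)
  have h₂ : ∀ q f, 𝒯.F q = some f → wt (Sum.elim (0 : 𝒯.R → ℕ) fun _ => 1) f ≤ K₁ + K₂ :=
    fun q f h => le_add_left (hK₂ ⟨q, by simp [h]⟩)
  have key : ∀ w q ν v, 𝒯.evalFrom w q ν = some v →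
      v.length ≤ ∑ X, ((ν X).getD []).length + (K₁ + K₂) * (w.length + 1) := by
    intro w
    induction w with
    | nil =>
      intro q ν v h
      rw [DSST.evalFrom_nil, Option.bind_eq_some_iff] at h
      obtain ⟨f, hf, hv⟩ := h
      rw [← wt_one_eq_length, wt_subst _ hv]
      have : (fun x => wt (fun _ => 1) ((value ν x).getD [])) =
          Sum.elim (fun X => ((ν X).getD []).length) fun _ => 1 := by
        funext x
        cases x <;> simp [value, wt_one_eq_length]
      rw [this, wt_sum_elim]
      simp only [List.length_nil, zero_add, mul_one]
      refine Nat.add_le_add (Finset.sum_le_sum fun X _ => ?_) (h₂ q f hf)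
      exact (Nat.mul_le_mul_right _ (𝒯.final_once q f hf X)).trans (one_mul _).le
    | cons a w ih =>
      intro q ν v h
      simp only [DSST.evalFrom, Option.bind_eq_some_iff] at h
      obtain ⟨p, hp, hv⟩ := h
      refine (ih _ _ _ hv).trans ?_
      have h3 : ∑ X, (((ν.comp p.1) X).getD []).length ≤
          totalWt (fun X => ((ν X).getD []).length) (fun _ => 1) p.1 := by
        refine Finset.sum_le_sum fun X _ => ?_
        simp only [Valuation.comp]
        cases hX : p.1 X with
        | none => simp
        | some u =>
          simp only [Option.bind_some, extend_eq_subst, Option.getD_some]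
          rw [← wt_one_eq_length]
          refine (wt_getD_subst_le _ _ _).trans (wt_mono (fun x => ?_) _)
          cases x <;> simp [value, wt_one_eq_length]
      have h4 := (𝒯.copyless q a p.1 p.2 hp).totalWt_le (fun X => ((ν X).getD []).length) fun _ => 1
      have h5 := h₁ q a p hp
      have h6 : (K₁ + K₂) * (w.length + 1 + 1) = (K₁ + K₂) * (w.length + 1) + (K₁ + K₂) :=
        mul_add_one _ _
      rw [List.length_cons]
      omega
  exact ⟨K₁ + K₂, fun w v h => by simpa using key w _ _ v h⟩

/-- For nonempty w the constant term is absorbed by |w| + 1 ≤ 2|w|; the empty word has to be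
excluded separately. -/
theorem DSST.hasLinearGrowth [Finite A] (𝒯 : DSST A B) (h : 𝒯.eval [] = none) :
    HasLinearGrowth 𝒯.eval := by
  obtain ⟨K, hK⟩ := 𝒯.exists_length_le
  refine ⟨2 * K, fun w v hv => (hK w v hv).trans ?_⟩
  cases w with
  | nil => simp [h] at hv
  | cons a w =>
    rw [mul_comm 2, mul_assoc]
    exact Nat.mul_le_mul_left _ (by rw [List.length_cons]; omega)

instance {X : Type*} [Finite A] [Finite X] : Finite (RefSym A X) := by
  refine Finite.of_injective (β := A ⊕ X ⊕ X) (fun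
    | .letter a => .inl a
    | .opn x => .inr (.inl x)
    | .cls x => .inr (.inr x)) fun c c' h => ?_
  cases c <;> cases c' <;> simp_all

end Growth

/-! ### From nondeterministic streaming string transducers to linear programs -/

section Universal

variable {A X : Type*}

theorem Expr.mem_lang_foldr_alt (R : Expr A X) (l : List (Expr A X)) (w : List (RefSym A X)) :
    w ∈ (l.foldr Expr.alt R).lang ↔ w ∈ R.lang ∨ ∃ R' ∈ l, w ∈ R'.lang := by
  induction l with
  | nil => simp
  | cons R' l ih =>
    rw [List.foldr_cons]
    refine Iff.trans (or_congr Iff.rfl ih) ?_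
    simp only [List.mem_cons, exists_eq_or_imp]
    tauto

theorem Expr.wellFormed_foldr_alt {R : Expr A X} {l : List (Expr A X)} (hR : R.WellFormed)
    (hl : ∀ R' ∈ l, R'.WellFormed) : (l.foldr Expr.alt R).WellFormed := by
  induction l with
  | nil => exact hR
  | cons R' l ih => exact ⟨hl R' (by simp), ih fun R'' h => hl R'' (by simp [h])⟩

/-- The expression for an empty span of `x`. -/
def Expr.mark (x : X) : Expr A X := .bind x .eps

theorem Expr.mem_lang_mark (x : X) (w : List (RefSym A X)) :
    w ∈ (Expr.mark x : Expr A X).lang ↔ w = [.opn x, .cls x] := by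
  constructor
  · rintro ⟨_, ⟨_, rfl, _, rfl, rfl⟩, _, rfl, rfl⟩
    rfl
  · rintro rfl
    exact ⟨_, ⟨_, rfl, _, rfl, rfl⟩, _, rfl, rfl⟩

/-- The expression for all documents with exactly one variable marked at every position. -/
noncomputable def Expr.marked [Finite A] [Finite X] (x₀ : X) : Expr A X :=
  .cat (.star (((univBag (X × A)).toList.map fun p =>
      Expr.cat (Expr.mark p.1) (Expr.sym p.2)).foldr Expr.alt Expr.eps))
    (((univBag X).toList.map Expr.mark).foldr Expr.alt (Expr.mark x₀))

variable [Finite A] [Finite X]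

theorem Expr.wellFormed_marked (x₀ : X) : (Expr.marked x₀ : Expr A X).WellFormed := by
  refine ⟨Expr.wellFormed_foldr_alt trivial ?_, Expr.wellFormed_foldr_alt ⟨id, trivial⟩ ?_⟩
  · simp only [List.mem_map]
    rintro _ ⟨p, -, rfl⟩
    exact ⟨⟨id, trivial⟩, trivial⟩
  · simp only [List.mem_map]
    rintro _ ⟨p, -, rfl⟩
    exact ⟨id, trivial⟩

/-- The word for a document with one variable marked at every position. -/
def markedWord : List X → List A → List (RefSym A X)
  | [], _ => []
  | x :: _, [] => [.opn x, .cls x]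
  | x :: xs, a :: D => .opn x :: .cls x :: .letter a :: markedWord xs D

theorem Expr.mem_lang_marked (x₀ : X) (w : List (RefSym A X)) :
    w ∈ (Expr.marked x₀ : Expr A X).lang ↔
      ∃ xs D, xs.length = D.length + 1 ∧ w = markedWord xs D := by
  constructor
  · rintro ⟨_, ⟨l, rfl, hl⟩, v, hv, rfl⟩
    obtain ⟨x, rfl⟩ : ∃ x, v = [.opn x, .cls x] := by
      rcases (Expr.mem_lang_foldr_alt _ _ _).1 hv with hv | ⟨R', hR', hv⟩
      · exact ⟨x₀, (Expr.mem_lang_mark _ _).1 hv⟩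
      · obtain ⟨x, -, rfl⟩ := List.mem_map.1 hR'
        exact ⟨x, (Expr.mem_lang_mark x v).1 hv⟩
    induction l with
    | nil => exact ⟨[x], [], rfl, rfl⟩
    | cons u l ih =>
      obtain ⟨xs, D, hxs, h⟩ := ih fun y hy => hl y (by simp [hy])
      have hu := hl u (by simp)
      rw [Expr.mem_lang_foldr_alt] at hu
      dsimp only at h ⊢
      rw [List.flatten_cons, List.append_assoc, h]
      rcases hu with hu | ⟨R', hR', hu⟩
      -- The alternative `Expr.eps` only starts the fold; an empty factor of the star changes
      -- nothing.
      · cases hu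
        exact ⟨xs, D, hxs, rfl⟩
      · obtain ⟨⟨y, a⟩, -, rfl⟩ := List.mem_map.1 hR'
        obtain ⟨u₁, hu₁, _, rfl, rfl⟩ := hu
        rw [(Expr.mem_lang_mark y u₁).1 hu₁]
        exact ⟨y :: xs, a :: D, by simp [hxs], rfl⟩
  · rintro ⟨xs, D, hxs, rfl⟩
    have key : ∃ l : List (List (RefSym A X)), ∃ x, markedWord xs D = l.flatten ++ [.opn x, .cls x] ∧
        ∀ y ∈ l, ∃ x a, y = [.opn x, .cls x, .letter a] := by
      induction D generalizing xs with
      | nil =>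
        obtain ⟨x, rfl⟩ := List.length_eq_one_iff.1 hxs
        exact ⟨[], x, rfl, by simp⟩
      | cons a D ih =>
        cases xs with
        | nil => simp at hxs
        | cons x xs =>
          obtain ⟨l, y, h, hl⟩ := ih xs (by simpa using hxs)
          refine ⟨[.opn x, .cls x, .letter a] :: l, y, by simp [markedWord, h], ?_⟩
          simp only [List.mem_cons, forall_eq_or_imp]
          exact ⟨⟨x, a, rfl⟩, hl⟩
    obtain ⟨l, x, h, hl⟩ := key
    rw [h]
    refine ⟨_, ⟨l, rfl, fun y hy => ?_⟩, _, ?_, rfl⟩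
    · obtain ⟨x, a, rfl⟩ := hl y hy
      rw [Expr.mem_lang_foldr_alt]
      refine .inr ⟨_, List.mem_map.2 ⟨(x, a), by simpa using mem_univBag (x, a), rfl⟩, ?_⟩
      exact ⟨_, (Expr.mem_lang_mark x _).2 rfl, _, rfl, rfl⟩
    · exact (Expr.mem_lang_foldr_alt _ _ _).2 <| .inr ⟨_, List.mem_map.2 ⟨x, by simpa using mem_univBag x, rfl⟩,
        (Expr.mem_lang_mark x _).2 rfl⟩

/-- The label of a gap in which only the empty span of `x` is marked. -/
def markLabel [DecidableEq X] (x : X) : Label X :=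
  Function.update (fun _ => (false, false, false)) x (false, true, false)

theorem markLabel_injective [DecidableEq X] : Function.Injective (markLabel : X → Label X) := by
  intro x y h
  by_contra hne
  have := congrFun h x
  simp [markLabel, Function.update_of_ne hne] at this

theorem doc_markedWord (xs : List X) (D : List A) (h : xs.length = D.length + 1) :
    doc (markedWord xs D) = D := by
  induction D generalizing xs with
  | nil =>
    obtain ⟨x, rfl⟩ := List.length_eq_one_iff.1 h
    rfl
  | cons a D ih =>
    cases xs with
    | nil => simp at h
    | cons x xs => simp [markedWord, doc, ih xs (by simpa using h)]

theorem labels_markedWord [DecidableEq X] (xs : List X) (D : List A)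
    (h : xs.length = D.length + 1) : labels (markedWord xs D) = xs.map markLabel := by
  have hm : ∀ x : X, Function.update (Function.update (fun _ : X => (false, false, false)) x
      (true, false, false)) x (false, true, false) = markLabel x := fun x => by
    simp [markLabel]
  induction D generalizing xs with
  | nil =>
    obtain ⟨x, rfl⟩ := List.length_eq_one_iff.1 h
    simp [markedWord, labels, hm]
  | cons a D ih =>
    cases xs with
    | nil => simp at h
    | cons x xs => simp [markedWord, labels, hm, ih xs (by simpa using h)]

end Universal

/-! ### Variables as indices of transitions -/

section ToProgram

variable {A C : Type*} {m : ℕ}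

theorem labelWord_markLabel (k : Fin m) :
    (labelWord (markLabel k) : List (RefSym A (Fin m))) = [.opn k, .cls k] := by
  have key : ∀ l : List (Fin m), l.Nodup → k ∈ l → l.flatMap (fun x =>
      (if (markLabel k x).1 then [RefSym.cls x] else []) ++
      (if (markLabel k x).2.1 then [RefSym.opn x, RefSym.cls x] else []) ++
      (if (markLabel k x).2.2 then [RefSym.opn x] else [])) =
        ([.opn k, .cls k] : List (RefSym A (Fin m))) := by
    have hne : ∀ x, x ≠ k → markLabel k x = (false, false, false) := fun x hx => by
      simp [markLabel, hx]
    intro l hl hk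
    induction l with
    | nil => simp at hk
    | cons y l ih =>
      rw [List.nodup_cons] at hl
      rw [List.flatMap_cons]
      by_cases hy : y = k
      · subst hy
        rw [List.flatMap_eq_nil_iff.2]
        · simp [markLabel]
        · intro x hx
          rw [hne x fun h => hl.1 (h ▸ hx)]
          rfl
      · rw [ih hl.2 ((List.mem_cons.1 hk).resolve_left (Ne.symm hy)), hne y hy]
        rfl
  exact key _ (Finset.sort_nodup _ _) (by simp)

/-- The canonical encoding is literally the marked word, so the DSST meets no other arrangement of
brackets. -/
theorem encodeLabels_markLabel (ks : List (Fin m)) (D : List A) :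
    encodeLabels (ks.map markLabel) D = markedWord ks D := by
  induction D generalizing ks with
  | nil => cases ks <;> simp [encodeLabels, markedWord, labelWord_markLabel]
  | cons a D ih => cases ks <;> simp [encodeLabels, markedWord, labelWord_markLabel, ih]

/-- Every occurrence in the bag has exactly one index and indices out of range give nothing, so
multiplicities are preserved. -/
theorem univBag_filterMap_getElem? {β : Type*} (s : Multiset β) (h : s.card ≤ m) :
    (univBag (Fin m)).filterMap (fun k => s.toList[k.1]?) = s := by
  have key : ∀ (m : ℕ) (l : List β), l.length ≤ m →
      (List.finRange m).filterMap (fun k => l[k.1]?) = l := by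
    intro m l
    induction l generalizing m with
    | nil => simp
    | cons b l ih =>
      intro h
      cases m with
      | zero => simp at h
      | succ m =>
        rw [List.finRange_succ, List.filterMap_cons]
        simp only [Fin.val_zero, List.getElem?_cons_zero, List.filterMap_map]
        congr 1
        exact ih m (by simpa using h)
  have hu : univBag (Fin m) = (List.finRange m : Multiset (Fin m)) := by
    refine (Multiset.Nodup.ext (nodup_univBag _)
      (Multiset.coe_nodup.2 (List.nodup_finRange m))).2 fun k => ?_
    simp [mem_univBag]
  rw [hu, Multiset.filterMap_coe, key m s.toList (by simpa using h), Multiset.coe_toList]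

variable (N : NSST A C)

/-- The deterministic transducer that reads the indices of the transitions of `N`. -/
@[reducible] noncomputable def NSST.toDSST (m : ℕ) : DSST (RefSym A (Fin m)) C where
  Q := N.Q × Option (Fin m)
  R := N.R
  finQ := Fintype.ofFinite _
  Δ
    | (q, none), .opn k => some (idAssignment, q, some k)
    | (q, some k), .cls _ => some (idAssignment, q, some k)
    | (q, some k), .letter a => (N.δ q a).toList[k.1]?.map fun p => (p.1, p.2, none)
    | _, _ => none
  copyless := by
    rintro ⟨q, _ | k⟩ (a | x | x) σ q' h
    · simp at h
    · simp only [Option.some.injEq, Prod.mk.injEq] at h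
      rw [← h.1]
      exact copyless_id
    · simp at h
    · simp only [Option.map_eq_some_iff, Prod.mk.injEq] at h
      obtain ⟨p, hp, rfl, -⟩ := h
      exact N.copyless q a p (by simpa using List.mem_of_getElem? hp)
    · simp at h
    · simp only [Option.some.injEq, Prod.mk.injEq] at h
      rw [← h.1]
      exact copyless_id
  q₀ := (N.q₀, none)
  F
    | (_, none) => none
    | (q, some k) => (N.F q).toList[k.1]?
  final_once := by
    rintro ⟨q, _ | k⟩ w h
    · simp at h
    · exact N.final_once q w (by simpa using List.mem_of_getElem? h)

/-- A run is a sequence of |D| + 1 indices: one for each letter and one for the final word.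
Sequences with an index out of range drop out. -/
theorem NSST.filterMap_evalFrom_toDSST (hδ : ∀ q a, (N.δ q a).card ≤ m) (hF : ∀ q, (N.F q).card ≤ m)
    (D : List A) (q : N.Q) (ν : Valuation N.R C) :
    (words (Fin m) (D.length + 1)).filterMap
        (fun ks => (N.toDSST m).evalFrom (markedWord ks D) (q, none) ν) =
      (N.sym D q).filterMap (subst (value ν)) := by
  induction D generalizing q ν with
  | nil =>
    simp only [List.length_nil, words, Multiset.map_singleton, Multiset.bind_singleton,
      Multiset.filterMap_map, sym]
    conv_rhs => rw [← univBag_filterMap_getElem? _ (hF q), Multiset.filterMap_filterMap]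
    congr 1
    funext k
    -- Each of the two brackets applies the identity assignment.
    change ((N.toDSST m).evalFrom [] (q, some k) ((ν.comp idAssignment).comp idAssignment)) = _
    rw [valuation_comp_id, valuation_comp_id, DSST.evalFrom_nil]
  | cons a D ih =>
    rw [List.length_cons, words, Multiset.filterMap_bind, sym]
    conv_rhs => rw [← univBag_filterMap_getElem? _ (hδ q a), Multiset.filterMap_bind,
      Multiset.bind_filterMap]
    refine Multiset.bind_congr fun k _ => ?_
    rw [Multiset.filterMap_map]
    have h : ∀ ks, (N.toDSST m).evalFrom (markedWord (k :: ks) (a :: D)) (q, none) ν =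
        ((N.δ q a).toList[k.1]?).bind fun p =>
          (N.toDSST m).evalFrom (markedWord ks D) (p.2, none) (ν.comp p.1) := by
      intro ks
      change (Option.map _ _).bind
        (fun p : Assignment N.R C × N.Q × Option (Fin m) => (N.toDSST m).evalFrom _ p.2 (((ν.comp idAssignment).comp idAssignment).comp p.1)) = _
      rw [valuation_comp_id, valuation_comp_id]
      cases (N.δ q a).toList[k.1]? <;> rfl
    simp only [Function.comp_def, h]
    cases (N.δ q a).toList[k.1]? with
    | none =>
      refine Multiset.eq_zero_of_forall_notMem fun v hv => ?_
      simp [Multiset.mem_filterMap] at hv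
    | some p =>
      simp only [Option.bind_some, Option.map_some, Option.getD_some, ih,
        Multiset.filterMap_filterMap]
      congr 1
      funext w
      exact (bind_subst_value _ _ _).symm

theorem NSST.exists_program [Finite A] : ∃ (m : ℕ) (P : Program A (Fin m) C), P.IsLinear ∧
    HasLinearGrowth P.T ∧ ∀ D, P.eval D = N.eval D := by
  classical
  obtain ⟨K₁, hK₁⟩ := (Set.finite_range fun p : N.Q × A => (N.δ p.1 p.2).card).bddAbove
  obtain ⟨K₂, hK₂⟩ := (Set.finite_range fun q : N.Q => (N.F q).card).bddAbove
  -- The summand 1 ensures that there is a variable for the default in `Expr.marked`.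
  set m := K₁ + K₂ + 1 with hm
  have hδ : ∀ q a, (N.δ q a).card ≤ m := fun q a => (hK₁ ⟨(q, a), rfl⟩).trans (by omega)
  have hF : ∀ q, (N.F q).card ≤ m := fun q => (hK₂ ⟨q, rfl⟩).trans (by omega)
  let R : Expr A (Fin m) := Expr.marked ⟨0, by omega⟩
  have hR : R.WellFormed := Expr.wellFormed_marked _
  -- The DSST rejects the empty word because no index has been read in its initial state; this is
  -- the `rfl` passed to `hasLinearGrowth`.
  refine ⟨m, ⟨languageMultispanner R.lang, (N.toDSST m).eval⟩, ⟨⟨R, hR, rfl⟩, _, rfl⟩,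
    (N.toDSST m).hasLinearGrowth rfl, fun D => ?_⟩
  rw [eval_eq_filterMap_words _ R hR rfl]
  have h : (words (Fin m) (D.length + 1)).map (List.map markLabel) =
      (words (Label (Fin m)) (D.length + 1)).filter fun zs =>
        ∃ w ∈ R.lang, doc w = D ∧ labels w = zs := by
    refine (Multiset.Nodup.ext ((nodup_words _ _).map
      (List.map_injective_iff.2 markLabel_injective)) ((nodup_words _ _).filter _)).2 fun zs => ?_
    simp only [Multiset.mem_map, Multiset.mem_filter, mem_words]
    constructor
    · rintro ⟨ks, hks, rfl⟩
      exact ⟨by simpa using hks, _, (Expr.mem_lang_marked _ _).2 ⟨ks, D, hks, rfl⟩,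
        doc_markedWord ks D hks, labels_markedWord ks D hks⟩
    · rintro ⟨-, w, hw, hD, rfl⟩
      obtain ⟨ks, D', hks, rfl⟩ := (Expr.mem_lang_marked _ _).1 hw
      rw [doc_markedWord ks D' hks] at hD
      subst hD
      exact ⟨ks, hks, (labels_markedWord ks D' hks).symm⟩
  have h' := Multiset.filterMap_map (List.map markLabel)
    (fun zs => (N.toDSST m).eval (encodeLabels zs D)) (words (Fin m) (D.length + 1))
  rw [h, Multiset.filterMap_filter] at h'
  refine Eq.trans ?_ (h'.trans (Eq.trans ?_
    (N.filterMap_evalFrom_toDSST hδ hF D N.q₀ emptyValuation)))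
  · congr
  · congr 1
    funext ks
    simp only [Function.comp_apply, encodeLabels_markLabel]
    rfl

end ToProgram

end ET

theorem mainTheorem5 {A B C X₁ X₂ : Type*} [Finite A] [Finite B] [Finite C]
    [Fintype X₁] [LinearOrder X₁] [Fintype X₂] [LinearOrder X₂]
    (P₁ : ET.Program A X₁ B) (P₂ : ET.Program B X₂ C)
    (h₁ : P₁.IsLinear) (h₂ : P₂.IsLinear) :
    ∃ (m : ℕ) (P : ET.Program A (Fin m) C), P.IsLinear ∧ ET.HasLinearGrowth P.T ∧
      ∀ D : List A, P.eval D = ET.compEval P₁ P₂ D := by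
  obtain ⟨N₁, hN₁⟩ := h₁.exists_nsst
  obtain ⟨N₂, hN₂⟩ := h₂.exists_nsst
  obtain ⟨N, hN⟩ := N₁.exists_comp N₂
  obtain ⟨m, P, hP, hT, h⟩ := N.exists_program
  refine ⟨m, P, hP, hT, fun D => ?_⟩
  rw [h, hN, hN₁, ET.compEval]
  simp only [hN₂]
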